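/- Let $n\ge 0$ be an integer and $J=\begin{pmatrix}0&-I\\ I&0\end{pmatrix}\in\mathbb C^{2n\times 2n}$. Let $H:(0,\infty)\to\mathbb C^{2n\times 2n}$ be locally integrable on $(0,\infty)$ with $H(x)\ge 0$ for almost every $x$. Let $L^2_H(0,\infty)$ be the space of measurable $f:(0,\infty)\to\mathbb C^{2n}$ with $\|f\|^2=\int_0^\infty f^*Hf\,dx<\infty$, modulo those with $\|f\|=0$. The maximal relation of $H$ is $$\mathcal T=\{(f,g)\in L^2_H(0,\infty)\oplus L^2_H(0,\infty): f \text{ has a locally absolutely continuous representative } f_0 \text{ with } Jf_0'=-Hg \text{ a.e. on } (0,\infty)\},$$ and the deficiency indices of $H$ are the dimensions of $\ker(\mathcal T-i)$ and $\ker(\mathcal T+i)$, where $\ker(\mathcal T-z)=\{f:(f,zf)\in\mathcal T\}$. Assume that $0$ is a regular endpoint, i.e. $H\in L^1(0,c)$ for some $c>0$, and that $H$ is definite on $(0,\infty)$, i.e. the only $v\in\mathbb C^{2n}$ with $H(x)v=0$ for almost every $x\in(0,\infty)$ is $v=0$. Then, for every $(f,g)\in\mathcal T$, the representative $f_0$ above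 is uniquely determined by $(f,g)$. **Theorem.** Under these assumptions, both deficiency indices of $H$ are equal to $n$ if and only if $$\lim_{x\to\infty} f_0(x)^*Jh_0(x)=0\qquad\text{for all } (f,g),(h,k)\in\mathcal T.$$ -/

import Mathlib

open MeasureTheory Set Filter Topology Matrix
open scoped ComplexOrder ENNReal

noncomputable section

/-- The matrix `J = (0, -I; I, 0)` of size `2n`; the `2n` indices are `Fin n ⊕ Fin n`. -/
abbrev symplJ (n : ℕ) : Matrix (Fin n ⊕ Fin n) (Fin n ⊕ Fin n) ℂ :=
  Matrix.J (Fin n) ℂ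

/-- A canonical system of order `2n` on the half line `(0, ∞)`: a matrix function `H` which is
positive semidefinite almost everywhere and locally integrable on `(0, ∞)`. The values of `H`
outside `(0, ∞)` are never used. -/
structure CanonicalSystem (n : ℕ) where
  /-- the coefficient matrix `H(x)` -/
  H : ℝ → Matrix (Fin n ⊕ Fin n) (Fin n ⊕ Fin n) ℂ
  posSemidef : ∀ᵐ x ∂volume.restrict (Ioi 0), (H x).PosSemidef
  locallyIntegrable : ∀ i j, LocallyIntegrableOn (fun x => H x i j) (Ioi 0)

namespace CanonicalSystem

variable {n : ℕ} (S : CanonicalSystem n)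

/-- The left endpoint `0` is regular: `H ∈ L¹(0, c)` for some `c > 0`. -/
def RegularAtZero : Prop :=
  ∃ c : ℝ, 0 < c ∧ ∀ i j, IntegrableOn (fun x => S.H x i j) (Ioo 0 c)

/-- `H` is definite on `(0, ∞)`: a constant vector `v` with `H(x) v = 0` for almost every `x`
vanishes. -/
def Definite : Prop :=
  ∀ v : Fin n ⊕ Fin n → ℂ, (∀ᵐ x ∂volume.restrict (Ioi 0), S.H x *ᵥ v = 0) → v = 0

/-- The density `f(x)* H(x) f(x)`, which is a nonnegative real number wherever `H(x) ≥ 0`. -/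
def density (f : ℝ → Fin n ⊕ Fin n → ℂ) (x : ℝ) : ℝ≥0∞ :=
  ENNReal.ofReal (star (f x) ⬝ᵥ (S.H x *ᵥ f x)).re

/-- The squared seminorm `∫₀^∞ f* H f`, with values in `[0, ∞]`. -/
def sqNorm (f : ℝ → Fin n ⊕ Fin n → ℂ) : ℝ≥0∞ :=
  ∫⁻ x in Ioi 0, S.density f x

lemma aemeasurable_density {f : ℝ → Fin n ⊕ Fin n → ℂ}
    (hf : AEMeasurable f (volume.restrict (Ioi 0))) :
    AEMeasurable (S.density f) (volume.restrict (Ioi 0)) := by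
  have hH : ∀ i j, AEMeasurable (fun x => S.H x i j) (volume.restrict (Ioi 0)) := fun i j =>
    (S.locallyIntegrable i j).aestronglyMeasurable.aemeasurable
  have hfi : ∀ i, AEMeasurable (fun x => f x i) (volume.restrict (Ioi 0)) := fun i =>
    (measurable_pi_apply i).comp_aemeasurable hf
  unfold density
  refine ENNReal.measurable_ofReal.comp_aemeasurable (Complex.measurable_re.comp_aemeasurable ?_)
  simp only [dotProduct, mulVec, Pi.star_apply]
  refine Finset.aemeasurable_fun_sum _ fun i _ => ?_
  refine AEMeasurable.mul ?_ (Finset.aemeasurable_fun_sum _ fun j _ => (hH i j).mul (hfi j))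
  exact (continuous_star.measurable).comp_aemeasurable (hfi i)

lemma density_add_le {f g : ℝ → Fin n ⊕ Fin n → ℂ} {x : ℝ} (hx : (S.H x).PosSemidef) :
    S.density (f + g) x ≤ 2 * (S.density f x + S.density g x) := by
  have h1 := (Complex.le_def.1 (hx.dotProduct_mulVec_nonneg (f x - g x))).1
  have hf := (Complex.le_def.1 (hx.dotProduct_mulVec_nonneg (f x))).1
  have hg := (Complex.le_def.1 (hx.dotProduct_mulVec_nonneg (g x))).1
  simp only [Complex.zero_re] at h1 hf hg
  unfold density
  rw [← ENNReal.ofReal_add hf hg, ← ENNReal.ofReal_ofNat 2,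
    ← ENNReal.ofReal_mul (by norm_num)]
  apply ENNReal.ofReal_le_ofReal
  simp only [Pi.add_apply, star_add, star_sub, mulVec_add, mulVec_sub, add_dotProduct,
    sub_dotProduct, dotProduct_add, dotProduct_sub, Complex.add_re, Complex.sub_re] at h1 ⊢
  linarith

lemma sqNorm_add_le {f g : ℝ → Fin n ⊕ Fin n → ℂ}
    (hf : AEMeasurable f (volume.restrict (Ioi 0))) :
    S.sqNorm (f + g) ≤ 2 * (S.sqNorm f + S.sqNorm g) := by
  unfold sqNorm
  rw [← lintegral_add_left' (S.aemeasurable_density hf), ← lintegral_const_mul' _ _ (by simp)]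
  exact lintegral_mono_ae (S.posSemidef.mono fun x hx => S.density_add_le hx)

lemma sqNorm_smul (c : ℂ) (f : ℝ → Fin n ⊕ Fin n → ℂ) :
    S.sqNorm (c • f) = ENNReal.ofReal (‖c‖ ^ 2) * S.sqNorm f := by
  unfold sqNorm
  rw [← lintegral_const_mul' _ _ (by simp)]
  refine lintegral_congr fun x => ?_
  unfold density
  rw [← ENNReal.ofReal_mul (by positivity)]
  congr 1
  have : star c * c = ((‖c‖ ^ 2 : ℝ) : ℂ) := by
    rw [Complex.star_def, ← Complex.normSq_eq_conj_mul_self, Complex.normSq_eq_norm_sq]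
  rw [Pi.smul_apply, star_smul, mulVec_smul, smul_dotProduct, dotProduct_smul, smul_smul,
    this, smul_eq_mul, Complex.re_ofReal_mul]

@[simp] lemma sqNorm_zero : S.sqNorm 0 = 0 := by
  simp [sqNorm, density]

/-- The space `V` of measurable `f : (0, ∞) → ℂ²ⁿ` with `∫₀^∞ f* H f < ∞`. Functions are defined
on all of `ℝ`, but only their restrictions to `(0, ∞)`, up to null sets, matter. -/
def preL2 : Submodule ℂ (ℝ → Fin n ⊕ Fin n → ℂ) where
  carrier := {f | AEMeasurable f (volume.restrict (Ioi 0)) ∧ S.sqNorm f < ∞}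
  zero_mem' := ⟨aemeasurable_const, by simp⟩
  add_mem' := fun hf hg => ⟨hf.1.add hg.1, (S.sqNorm_add_le hf.1).trans_lt
    (ENNReal.mul_lt_top (by simp) (ENNReal.add_lt_top.2 ⟨hf.2, hg.2⟩))⟩
  smul_mem' := fun c f hf => ⟨hf.1.const_smul c, by
    rw [S.sqNorm_smul]; exact ENNReal.mul_lt_top ENNReal.ofReal_lt_top hf.2⟩

/-- The subspace `N ⊆ V` of functions of seminorm zero. -/
def nullL2 : Submodule ℂ S.preL2 where
  carrier := {f | S.sqNorm f = 0}
  zero_mem' := by simp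
  add_mem' := fun {f g} hf hg => by
    have hf' : S.sqNorm f = 0 := hf
    have hg' : S.sqNorm g = 0 := hg
    have := S.sqNorm_add_le (g := g) f.2.1
    rw [hf', hg'] at this
    simpa using this
  smul_mem' := fun c f hf => by
    have hf' : S.sqNorm f = 0 := hf
    simp [S.sqNorm_smul, hf']

/-- The space `L²_H(0, ∞) = V / N`. -/
abbrev L2 : Type := S.preL2 ⧸ S.nullL2

/-- Local absolute continuity on `(0, ∞)`: absolute continuity on every compact subinterval. -/
def LocallyAC (f : ℝ → Fin n ⊕ Fin n → ℂ) : Prop :=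
  ∀ a b : ℝ, 0 < a → a ≤ b → AbsolutelyContinuousOnInterval f a b

/-- `f₀` is an absolutely continuous function on `(0, ∞)` which represents the first component `f`
of `p = (f, g)` in `L²_H(0, ∞)` and satisfies `J f₀' = -H g` almost everywhere, the second component
being represented by `g`. -/
def IsACRep (p : S.L2 × S.L2) (f₀ : ℝ → Fin n ⊕ Fin n → ℂ) : Prop :=
  LocallyAC f₀ ∧ ∃ hf₀ : f₀ ∈ S.preL2, Submodule.Quotient.mk ⟨f₀, hf₀⟩ = p.1 ∧
    ∃ g : S.preL2, Submodule.Quotient.mk g = p.2 ∧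
      ∀ᵐ x ∂volume.restrict (Ioi 0), ∃ y : Fin n ⊕ Fin n → ℂ,
        HasDerivAt f₀ y x ∧ symplJ n *ᵥ y = -(S.H x *ᵥ (g : ℝ → Fin n ⊕ Fin n → ℂ) x)

lemma ae_mulVec_eq_zero {f : ℝ → Fin n ⊕ Fin n → ℂ}
    (hf : AEMeasurable f (volume.restrict (Ioi 0))) (h0 : S.sqNorm f = 0) :
    ∀ᵐ x ∂volume.restrict (Ioi 0), S.H x *ᵥ f x = 0 := by
  have h := (lintegral_eq_zero_iff' (S.aemeasurable_density hf)).1 h0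
  filter_upwards [h, S.posSemidef] with x hx hp
  have h1 := Complex.le_def.1 (hp.dotProduct_mulVec_nonneg (f x))
  refine (hp.dotProduct_mulVec_zero_iff (f x)).1 (Complex.ext ?_ h1.2.symm)
  exact le_antisymm (ENNReal.ofReal_eq_zero.1 hx) h1.1

lemma sqNorm_sub_eq_zero {f g : S.preL2} {F : S.L2} (hf : Submodule.Quotient.mk f = F)
    (hg : Submodule.Quotient.mk g = F) :
    S.sqNorm ((f : ℝ → Fin n ⊕ Fin n → ℂ) - (g : ℝ → Fin n ⊕ Fin n → ℂ)) = 0 := by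
  have h : f - g ∈ S.nullL2 := (Submodule.Quotient.eq S.nullL2).1 (hf.trans hg.symm)
  exact h

/-- If `H` is definite, then the function `f₀` is uniquely determined on `(0, ∞)` by `(f, g)`. -/
theorem IsACRep.eqOn (hdef : S.Definite) {p : S.L2 × S.L2} {f₀ h₀ : ℝ → Fin n ⊕ Fin n → ℂ}
    (hf : S.IsACRep p f₀) (hh : S.IsACRep p h₀) : EqOn f₀ h₀ (Ioi 0) := by
  obtain ⟨hfa, hfm, hfp, g, hgp, hfg⟩ := hf
  obtain ⟨hha, hhm, hhp, k, hkp, hhk⟩ := hh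
  have h1 := S.sqNorm_sub_eq_zero (f := ⟨f₀, hfm⟩) (g := ⟨h₀, hhm⟩) hfp hhp
  have h2 := S.sqNorm_sub_eq_zero hgp hkp
  have hd : ∀ᵐ x ∂volume.restrict (Ioi 0), HasDerivAt (f₀ - h₀) 0 x := by
    filter_upwards [hfg, hhk, S.ae_mulVec_eq_zero (g.2.1.sub k.2.1) h2]
    rintro x ⟨y, hy, hy'⟩ ⟨w, hw, hw'⟩ hx
    have hz : symplJ n *ᵥ (y - w) = 0 := by
      rw [mulVec_sub, hy', hw']
      rw [Pi.sub_apply, mulVec_sub, sub_eq_zero] at hx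
      rw [hx, sub_self]
    have hyw : y - w = 0 := by
      have := congrArg (fun v => symplJ n *ᵥ v) hz
      simpa only [mulVec_mulVec, Matrix.J_squared, neg_mulVec, one_mulVec, mulVec_zero,
        neg_eq_zero] using this
    simpa [hyw] using hy.sub hw
  have hc : ∀ x ∈ Ioi (0 : ℝ), (f₀ - h₀) x = (f₀ - h₀) 1 := by
    have key : ∀ a b : ℝ, 0 < a → a ≤ b → (f₀ - h₀) a = (f₀ - h₀) b := by
      intro a b ha hab
      have hac : AbsolutelyContinuousOnInterval (f₀ - h₀) a b := (hfa a b ha hab).sub (hha a b ha hab)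
      obtain ⟨C, hC⟩ := hac.const_of_ae_hasDerivAt_zero (by
        rw [ae_restrict_iff' measurableSet_Ioi] at hd
        filter_upwards [hd] with x hx hxm
        rw [uIcc_of_le hab] at hxm
        exact hx (ha.trans_le hxm.1))
      rw [hC a left_mem_uIcc, hC b right_mem_uIcc]
    intro x hx
    rcases le_total x 1 with h | h
    · exact key x 1 hx h
    · exact (key 1 x one_pos h).symm
  have hv : (f₀ - h₀) 1 = 0 := hdef _ (by
    filter_upwards [S.ae_mulVec_eq_zero (hfm.1.sub hhm.1) h1, ae_restrict_mem measurableSet_Ioi]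
      with x hx hxm
    rw [← hc x hxm]; exact hx)
  intro x hx
  exact sub_eq_zero.1 ((hc x hx).trans hv)

/-- The maximal relation `𝒯`, a linear subspace of `L²_H ⊕ L²_H`. -/
def maximalRelation : Submodule ℂ (S.L2 × S.L2) where
  carrier := {p | ∃ f₀, S.IsACRep p f₀}
  zero_mem' := by
    refine ⟨0, fun a b _ _ => ?_, S.preL2.zero_mem, rfl, 0, rfl, ?_⟩
    · exact ((LipschitzWith.const (0 : Fin n ⊕ Fin n → ℂ)).lipschitzOnWith
        (s := uIcc a b)).absolutelyContinuousOnInterval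
    · exact .of_forall fun x => ⟨0, hasDerivAt_const x 0, by simp⟩
  add_mem' := by
    rintro p q ⟨f, hf, hfm, hfp, g, hgp, hfg⟩ ⟨h, hh, hhm, hhq, k, hkq, hhk⟩
    refine ⟨f + h, fun a b ha hab => (hf a b ha hab).add (hh a b ha hab),
      S.preL2.add_mem hfm hhm, ?_, g + k, ?_, ?_⟩
    · rw [Prod.fst_add, ← hfp, ← hhq]; rfl
    · rw [Prod.snd_add, ← hgp, ← hkq]; rfl
    · filter_upwards [hfg, hhk]
      rintro x ⟨y, hy, hy'⟩ ⟨w, hw, hw'⟩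
      refine ⟨y + w, hy.add hw, ?_⟩
      rw [mulVec_add, hy', hw', Submodule.coe_add, Pi.add_apply, mulVec_add, neg_add]
  smul_mem' := by
    rintro c p ⟨f, hf, hfm, hfp, g, hgp, hfg⟩
    refine ⟨c • f, fun a b ha hab => (hf a b ha hab).const_smul c,
      S.preL2.smul_mem c hfm, ?_, c • g, ?_, ?_⟩
    · rw [Prod.smul_fst, ← hfp]; rfl
    · rw [Prod.smul_snd, ← hgp]; rfl
    · filter_upwards [hfg]
      rintro x ⟨y, hy, hy'⟩
      refine ⟨c • y, hy.const_smul c, ?_⟩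
      rw [mulVec_smul, hy', Submodule.coe_smul, Pi.smul_apply, mulVec_smul, smul_neg]

/-- `ker (𝒯 - z) = {f : (f, z f) ∈ 𝒯}`. -/
def defectSpace (z : ℂ) : Submodule ℂ S.L2 :=
  S.maximalRelation.comap (LinearMap.id.prod (z • LinearMap.id))

/-- The deficiency index `dim ker (𝒯 - z)`; the deficiency indices of `H` are the values at
`z = i` and `z = -i`. -/
def deficiencyIndex (z : ℂ) : Cardinal :=
  Module.rank ℂ (S.defectSpace z)

end CanonicalSystem

end

/-! Write `δ p` for the value at `0` of the absolutely continuous representative of `p ∈ 𝒯`; it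
exists by regularity and is unique by definiteness. Green's identity on `(0, x)` shows that `f₀(x)*
J h₀(x)` always converges as `x → ∞`, for `p = (f, g)` and `q = (h, k)`, to `B(p, q) = δ(p)* J δ(q)
+ ⟪g, h⟫ - ⟪f, k⟫` (`tendsto_green`, `IsACRep.tendsto`). The theorem thus says that both indices
equal `n` exactly when `B = 0`.

Two facts about canonical systems enter. Every vector of `ℂ²ⁿ` is `δ p` for some `p` whose
representative vanishes near infinity, and `B(p, ·) = 0` for such `p` (`exists_boundaryValue_eq`).
Moreover, the radical of `⟪g, h⟫ - ⟪f, k⟫` on `𝒯`, which plays the part of the minimal relation, has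
its adjoint inside `𝒯` (`mem_relation_of_form_eq_zero`).

The rest is linear algebra in the Hilbert space `L²_H`, whose completeness is proved first. By von
Neumann's formula (`exists_eq_add`), `𝒯` is the radical plus the two defect spaces. Since `δ` kills
the radical and is onto, the boundary values of `ker (𝒯 - i) × ker (𝒯 + i)` already fill `ℂ²ⁿ`. If
`B = 0`, this surjection is also injective, so the indices add up to `2n`; a sign argument bounds
each by `n`, so both are `n`. Conversely, if both are `n`, the surjection is injective by dimension.
Subtract from `p` an element vanishing near infinity with the same value at `0`: the difference has
no defect components, lies in the radical, and so `B(p, ·) = 0`. -/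

/-! ### Positive semidefinite matrices -/

section Matrices

variable {ι : Type*} [Fintype ι]

lemma Matrix.IsHermitian.star_dotProduct_mulVec {A : Matrix ι ι ℂ} (hA : A.IsHermitian)
    (u v : ι → ℂ) : star (star u ⬝ᵥ (A *ᵥ v)) = star v ⬝ᵥ (A *ᵥ u) := by
  rw [Matrix.star_dotProduct, star_star, Matrix.star_mulVec, hA.eq, Matrix.dotProduct_mulVec]

/-- A Cauchy–Schwarz inequality for a positive semidefinite form. -/
lemma Matrix.PosSemidef.two_mul_norm_dotProduct_mulVec_le {A : Matrix ι ι ℂ} (hA : A.PosSemidef)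
    (u v : ι → ℂ) :
    2 * ‖star u ⬝ᵥ (A *ᵥ v)‖ ≤ (star u ⬝ᵥ (A *ᵥ u)).re + (star v ⬝ᵥ (A *ᵥ v)).re := by
  -- The phase `θ` turns the cross term into its modulus, so the claim is nonnegativity of the form
  -- at `u - θ v`.
  obtain ⟨θ, hθ, hz⟩ := RCLike.exists_norm_eq_mul_self (star u ⬝ᵥ (A *ᵥ v))
  have h := (Complex.le_def.1 (hA.dotProduct_mulVec_nonneg (u - θ • v))).1
  have hs := (hA.isHermitian.star_dotProduct_mulVec u v).symm
  have hθ2 : θ * star θ = 1 := by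
    rw [Complex.star_def, Complex.mul_conj, Complex.normSq_eq_norm_sq, hθ]
    simp
  have hz' := congrArg Complex.re hz
  have hz2 : (star θ * star (star u ⬝ᵥ (A *ᵥ v))).re = ‖star u ⬝ᵥ (A *ᵥ v)‖ := by
    rw [← star_mul', ← hz]
    simp
  simp only [star_sub, star_smul, mulVec_sub, mulVec_smul, sub_dotProduct, dotProduct_sub,
    smul_dotProduct, dotProduct_smul, smul_eq_mul, hs, mul_sub, ← mul_assoc, hθ2, one_mul,
    Complex.sub_re, Complex.zero_re, hz2, ← hz] at h
  simp only [Complex.coe_algebraMap, Complex.ofReal_re] at h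
  linarith

variable [DecidableEq ι]

/-- Tikhonov regularization: `(A + ε)⁻¹ A w` converges, as `ε → 0`, to a vector with the same image
under `A` as `w`. -/
lemma Matrix.PosSemidef.exists_tendsto_inv_mulVec {A : Matrix ι ι ℂ} (hA : A.PosSemidef)
    (w : ι → ℂ) : ∃ p, A *ᵥ p = A *ᵥ w ∧
      Tendsto (fun m : ℕ => (A + ((1 / ((m : ℝ) + 1) : ℝ) : ℂ) • (1 : Matrix ι ι ℂ))⁻¹ *ᵥ (A *ᵥ w))
        atTop (𝓝 p) := by
  set U : Matrix ι ι ℂ := (hA.isHermitian.eigenvectorUnitary : Matrix ι ι ℂ)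
  set l : ι → ℝ := hA.isHermitian.eigenvalues
  have hUU : U * star U = 1 := Unitary.mul_star_self_of_mem hA.isHermitian.eigenvectorUnitary.2
  have hUU' : star U * U = 1 := Unitary.star_mul_self_of_mem hA.isHermitian.eigenvectorUnitary.2
  have hsp : A = U * diagonal (fun i => (l i : ℂ)) * star U := by
    have := hA.isHermitian.spectral_theorem
    rw [Unitary.conjStarAlgAut_apply] at this
    exact this
  have hl0 : ∀ i, 0 ≤ l i := hA.eigenvalues_nonneg
  have hmul : ∀ d e : ι → ℂ, (U * diagonal d * star U) * (U * diagonal e * star U)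
      = U * diagonal (fun i => d i * e i) * star U := by
    intro d e
    calc _ = U * diagonal d * (star U * U) * diagonal e * star U := by simp only [Matrix.mul_assoc]
      _ = _ := by rw [hUU', Matrix.mul_one, Matrix.mul_assoc U, diagonal_mul_diagonal]
  have hinv : ∀ m : ℕ, (A + ((1 / ((m : ℝ) + 1) : ℝ) : ℂ) • (1 : Matrix ι ι ℂ))⁻¹
      = U * diagonal (fun i => ((l i + 1 / ((m : ℝ) + 1) : ℝ) : ℂ)⁻¹) * star U := by
    intro m
    have h1 : A + ((1 / ((m : ℝ) + 1) : ℝ) : ℂ) • (1 : Matrix ι ι ℂ)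
        = U * diagonal (fun i => ((l i + 1 / ((m : ℝ) + 1) : ℝ) : ℂ)) * star U := by
      have : diagonal (fun i => ((l i + 1 / ((m : ℝ) + 1) : ℝ) : ℂ))
          = diagonal (fun i => (l i : ℂ)) + ((1 / ((m : ℝ) + 1) : ℝ) : ℂ) • (1 : Matrix ι ι ℂ) := by
        rw [smul_one_eq_diagonal, diagonal_add]
        congr 1
        ext i
        push_cast
        rfl
      rw [this, Matrix.mul_add, Matrix.add_mul, ← hsp, Matrix.mul_smul, Matrix.mul_one,
        Matrix.smul_mul, hUU]
    refine Matrix.inv_eq_right_inv ?_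
    rw [h1, hmul]
    have : (fun i => ((l i + 1 / ((m : ℝ) + 1) : ℝ) : ℂ) * ((l i + 1 / ((m : ℝ) + 1) : ℝ) : ℂ)⁻¹)
        = fun _ => 1 := by
      ext i
      refine mul_inv_cancel₀ (Complex.ofReal_ne_zero.2 ?_)
      have := hl0 i
      positivity
    rw [this, diagonal_one, Matrix.mul_one, hUU]
  -- The limit is the orthogonal projection of `w` onto the range of `A`: the factors `l / (l + ε)`
  -- tend to `1` for `l ≠ 0` and are `0` for `l = 0`.
  refine ⟨(U * diagonal (fun i => if l i = 0 then 0 else 1) * star U) *ᵥ w, ?_, ?_⟩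
  · rw [mulVec_mulVec]
    congr 1
    conv_lhs => rw [hsp]
    rw [hmul]
    conv_rhs => rw [hsp]
    congr 3
    ext i
    split_ifs with h <;> simp [h]
  · have hA' : ∀ m : ℕ, (A + ((1 / ((m : ℝ) + 1) : ℝ) : ℂ) • (1 : Matrix ι ι ℂ))⁻¹ *ᵥ (A *ᵥ w)
        = (U * diagonal (fun i => ((l i + 1 / ((m : ℝ) + 1) : ℝ) : ℂ)⁻¹ * (l i : ℂ)) * star U)
          *ᵥ w := by
      intro m
      rw [hinv, mulVec_mulVec, ← hmul, ← hsp]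
    simp only [hA']
    have hd : Tendsto (fun m : ℕ => fun i => ((l i + 1 / ((m : ℝ) + 1) : ℝ) : ℂ)⁻¹ * (l i : ℂ))
        atTop (𝓝 (fun i => if l i = 0 then 0 else 1)) := by
      refine tendsto_pi_nhds.2 fun i => ?_
      split_ifs with h
      · simp [h]
      · have h1 : Tendsto (fun m : ℕ => (l i + 1 / ((m : ℝ) + 1))) atTop (𝓝 (l i)) := by
          simpa using tendsto_const_nhds.add (tendsto_one_div_add_atTop_nhds_zero_nat (𝕜 := ℝ))
        have h2 := ((Complex.continuous_ofReal.tendsto _).comp h1).inv₀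
          (Complex.ofReal_ne_zero.2 h)
        have h3 := h2.mul_const (l i : ℂ)
        rw [inv_mul_cancel₀ (Complex.ofReal_ne_zero.2 h)] at h3
        exact h3
    have hc : Continuous fun d : ι → ℂ => (U * diagonal d * star U) *ᵥ w := by fun_prop
    exact (hc.tendsto _).comp hd

lemma measurable_matrix_inv_apply (i j : ι) :
    Measurable fun A : ι → ι → ℂ => (Matrix.of A)⁻¹ i j := by
  have h : (fun A : ι → ι → ℂ => (Matrix.of A)⁻¹ i j)
      = fun A => (Matrix.det (Matrix.of A))⁻¹ * (Matrix.of A).adjugate i j := by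
    ext A
    rw [Matrix.inv_def, Matrix.smul_apply, smul_eq_mul, Ring.inverse_eq_inv']
  rw [h]
  have h0 : Continuous fun A : ι → ι → ℂ => (Matrix.of A : Matrix ι ι ℂ) := continuous_id
  exact (h0.matrix_det.measurable.inv).mul (h0.matrix_adjugate.matrix_elem i j).measurable

end Matrices

/-! ### Absolutely continuous functions -/

section AC

variable {E F : Type*} [NormedAddCommGroup E] [NormedAddCommGroup F]

/-- A transfer principle that covers components, conjugates and primitives of vector-valued
functions. -/
lemma AbsolutelyContinuousOnInterval.of_dist_le {f : ℝ → E} {g : ℝ → F} {a b : ℝ}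
    (hg : AbsolutelyContinuousOnInterval g a b)
    (h : ∀ x ∈ uIcc a b, ∀ y ∈ uIcc a b, dist (f x) (f y) ≤ dist (g x) (g y)) :
    AbsolutelyContinuousOnInterval f a b := by
  rw [absolutelyContinuousOnInterval_iff] at hg ⊢
  intro ε hε
  obtain ⟨δ, hδ, H⟩ := hg ε hε
  refine ⟨δ, hδ, fun I hI hlt => (Finset.sum_le_sum fun i hi => ?_).trans_lt (H I hI hlt)⟩
  exact h _ (hI.1 i hi).1 _ (hI.1 i hi).2

lemma AbsolutelyContinuousOnInterval.finset_sum {κ : Type*} (s : Finset κ) {f : κ → ℝ → E}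
    {a b : ℝ} (hf : ∀ i ∈ s, AbsolutelyContinuousOnInterval (f i) a b) :
    AbsolutelyContinuousOnInterval (fun x => ∑ i ∈ s, f i x) a b := by
  classical
  induction s using Finset.induction_on with
  | empty =>
    simpa using ((LipschitzWith.const (0 : E)).lipschitzOnWith
      (s := uIcc a b)).absolutelyContinuousOnInterval
  | insert i s hi ih =>
    simp only [Finset.sum_insert hi]
    exact (hf i (Finset.mem_insert_self i s)).add
      (ih fun j hj => hf j (Finset.mem_insert_of_mem hj))

variable [NormedSpace ℝ E]

lemma IntervalIntegrable.absolutelyContinuousOnInterval_integral {φ : ℝ → E} {a b : ℝ}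
    (h : IntervalIntegrable φ volume a b) :
    AbsolutelyContinuousOnInterval (fun x => ∫ t in a..x, φ t) a b := by
  refine (h.norm.absolutelyContinuousOnInterval_intervalIntegral
    (c := a) left_mem_uIcc).of_dist_le fun x hx y hy => ?_
  have hi : ∀ x ∈ uIcc a b, IntervalIntegrable φ volume a x := fun x hx =>
    h.mono_set (uIcc_subset_uIcc_left hx)
  rw [dist_comm, dist_comm (∫ t in a..x, ‖φ t‖), dist_eq_norm, dist_eq_norm,
    intervalIntegral.integral_interval_sub_left (hi y hy) (hi x hx),
    intervalIntegral.integral_interval_sub_left (hi y hy).norm (hi x hx).norm, Real.norm_eq_abs]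
  exact intervalIntegral.norm_integral_le_abs_integral_norm

variable [CompleteSpace E]

/-- The fundamental theorem of calculus for absolutely continuous vector-valued functions. -/
lemma AbsolutelyContinuousOnInterval.integral_eq_sub_of_ae_hasDerivAt {f φ : ℝ → E} {a b : ℝ}
    (hf : AbsolutelyContinuousOnInterval f a b) (hφ : IntervalIntegrable φ volume a b)
    (hd : ∀ᵐ x, x ∈ uIcc a b → HasDerivAt f (φ x) x) :
    ∫ x in a..b, φ x = f b - f a := by
  have hac := hf.sub hφ.absolutelyContinuousOnInterval_integral
  obtain ⟨C, hC⟩ := hac.const_of_ae_hasDerivAt_zero (by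
    filter_upwards [hd, hφ.ae_hasDerivAt_integral] with x h1 h2 hx
    simpa using (h1 hx).sub (h2 hx a left_mem_uIcc))
  have ha := hC a left_mem_uIcc
  have hb := hC b right_mem_uIcc
  simp only [Pi.sub_apply, intervalIntegral.integral_same, sub_zero] at ha hb
  rw [ha, ← hb]
  abel

end AC

noncomputable section

namespace CanonicalSystem

variable {n : ℕ} (S : CanonicalSystem n)

/-! ### The inner product of `L²_H(0, ∞)` -/

/-- The pairing `∫₀^∞ f* H g`. -/
def pairing (f g : ℝ → Fin n ⊕ Fin n → ℂ) : ℂ :=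
  ∫ x in Ioi 0, star (f x) ⬝ᵥ (S.H x *ᵥ g x)

lemma aestronglyMeasurable_H (i j : Fin n ⊕ Fin n) :
    AEStronglyMeasurable (fun x => S.H x i j) (volume.restrict (Ioi 0)) :=
  (S.locallyIntegrable i j).aestronglyMeasurable

lemma aemeasurable_mulVec {f : ℝ → Fin n ⊕ Fin n → ℂ}
    (hf : AEMeasurable f (volume.restrict (Ioi 0))) :
    AEMeasurable (fun x => S.H x *ᵥ f x) (volume.restrict (Ioi 0)) := by
  refine aemeasurable_pi_lambda _ fun i => ?_
  simp only [mulVec, dotProduct]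
  exact Finset.aemeasurable_fun_sum _ fun j _ => (S.aestronglyMeasurable_H i j).aemeasurable.mul
    ((measurable_pi_apply j).comp_aemeasurable hf)

lemma aemeasurable_star_dotProduct {f g : ℝ → Fin n ⊕ Fin n → ℂ} {μ : Measure ℝ}
    (hf : AEMeasurable f μ) (hg : AEMeasurable g μ) :
    AEMeasurable (fun x => star (f x) ⬝ᵥ g x) μ := by
  simp only [dotProduct, Pi.star_apply]
  exact Finset.aemeasurable_fun_sum _ fun j _ =>
    (continuous_star.measurable.comp_aemeasurable ((measurable_pi_apply j).comp_aemeasurable hf)).mul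
      ((measurable_pi_apply j).comp_aemeasurable hg)

lemma integrable_re_of_mem_preL2 {f : ℝ → Fin n ⊕ Fin n → ℂ} (hf : f ∈ S.preL2) :
    Integrable (fun x => (star (f x) ⬝ᵥ (S.H x *ᵥ f x)).re) (volume.restrict (Ioi 0)) := by
  refine (lintegral_ofReal_ne_top_iff_integrable ?_ ?_).1 hf.2.ne
  · exact (Complex.measurable_re.comp_aemeasurable
      (aemeasurable_star_dotProduct hf.1 (S.aemeasurable_mulVec hf.1))).aestronglyMeasurable
  · filter_upwards [S.posSemidef] with x hx
    exact (Complex.le_def.1 (hx.dotProduct_mulVec_nonneg (f x))).1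

lemma integrable_pairing {f g : ℝ → Fin n ⊕ Fin n → ℂ} (hf : f ∈ S.preL2) (hg : g ∈ S.preL2) :
    Integrable (fun x => star (f x) ⬝ᵥ (S.H x *ᵥ g x)) (volume.restrict (Ioi 0)) := by
  refine ((S.integrable_re_of_mem_preL2 hf).add (S.integrable_re_of_mem_preL2 hg)).mono'
    (aemeasurable_star_dotProduct hf.1 (S.aemeasurable_mulVec hg.1)).aestronglyMeasurable ?_
  filter_upwards [S.posSemidef] with x hx
  have := hx.two_mul_norm_dotProduct_mulVec_le (f x) (g x)
  have h0 := norm_nonneg (star (f x) ⬝ᵥ (S.H x *ᵥ g x))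
  simp only [Pi.add_apply]
  linarith

lemma pairing_star (f g : ℝ → Fin n ⊕ Fin n → ℂ) :
    star (S.pairing f g) = S.pairing g f := by
  unfold pairing
  rw [Complex.star_def, ← integral_conj]
  refine integral_congr_ae ?_
  filter_upwards [S.posSemidef] with x hx
  exact hx.isHermitian.star_dotProduct_mulVec _ _

lemma pairing_add_right {f g h : ℝ → Fin n ⊕ Fin n → ℂ} (hf : f ∈ S.preL2) (hg : g ∈ S.preL2)
    (hh : h ∈ S.preL2) : S.pairing f (g + h) = S.pairing f g + S.pairing f h := by
  unfold pairing
  rw [← integral_add (S.integrable_pairing hf hg) (S.integrable_pairing hf hh)]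
  simp only [Pi.add_apply, mulVec_add, dotProduct_add]

lemma pairing_smul_right (c : ℂ) (f g : ℝ → Fin n ⊕ Fin n → ℂ) :
    S.pairing f (c • g) = c * S.pairing f g := by
  unfold pairing
  simp only [Pi.smul_apply, mulVec_smul, dotProduct_smul, smul_eq_mul, integral_const_mul]

lemma pairing_sub_right {f g h : ℝ → Fin n ⊕ Fin n → ℂ} (hf : f ∈ S.preL2) (hg : g ∈ S.preL2)
    (hh : h ∈ S.preL2) : S.pairing f (g - h) = S.pairing f g - S.pairing f h := by
  unfold pairing
  rw [← integral_sub (S.integrable_pairing hf hg) (S.integrable_pairing hf hh)]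
  simp only [Pi.sub_apply, mulVec_sub, dotProduct_sub]

/-- Since `H` may be singular, an element of `L²_H` determines only `H f` almost everywhere; by
Hermitian symmetry this is all the pairing sees. -/
lemma pairing_congr {f f' g g' : ℝ → Fin n ⊕ Fin n → ℂ}
    (hf : ∀ᵐ x ∂volume.restrict (Ioi 0), S.H x *ᵥ f x = S.H x *ᵥ f' x)
    (hg : ∀ᵐ x ∂volume.restrict (Ioi 0), S.H x *ᵥ g x = S.H x *ᵥ g' x) :
    S.pairing f g = S.pairing f' g' := by
  refine integral_congr_ae ?_
  filter_upwards [S.posSemidef, hf, hg] with x hx h1 h2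
  rw [h2, ← hx.isHermitian.star_dotProduct_mulVec, h1, hx.isHermitian.star_dotProduct_mulVec]

lemma pairing_self_re (f : ℝ → Fin n ⊕ Fin n → ℂ) (hf : f ∈ S.preL2) :
    (S.pairing f f).re = (S.sqNorm f).toReal := by
  have h0 : 0 ≤ᵐ[volume.restrict (Ioi 0)] fun x => (star (f x) ⬝ᵥ (S.H x *ᵥ f x)).re := by
    filter_upwards [S.posSemidef] with x hx
    exact (Complex.le_def.1 (hx.dotProduct_mulVec_nonneg (f x))).1
  unfold pairing sqNorm density
  rw [← integral_eq_lintegral_of_nonneg_ae h0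
    (S.integrable_re_of_mem_preL2 hf).aestronglyMeasurable]
  exact (integral_re (S.integrable_pairing hf hf)).symm

lemma mk_eq_mk_of_ae {f g : ℝ → Fin n ⊕ Fin n → ℂ} (hf : f ∈ S.preL2) (hg : g ∈ S.preL2)
    (h : ∀ᵐ x ∂volume.restrict (Ioi 0), S.H x *ᵥ f x = S.H x *ᵥ g x) :
    (Submodule.Quotient.mk ⟨f, hf⟩ : S.L2) = Submodule.Quotient.mk ⟨g, hg⟩ := by
  rw [Submodule.Quotient.eq]
  change S.sqNorm (f - g) = 0
  unfold sqNorm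
  refine (lintegral_congr_ae ?_).trans lintegral_zero
  filter_upwards [h] with x hx
  simp [density, mulVec_sub, hx]

lemma mk_eq_mk_iff {f g : S.preL2} :
    (Submodule.Quotient.mk f : S.L2) = Submodule.Quotient.mk g ↔
      ∀ᵐ x ∂volume.restrict (Ioi 0), S.H x *ᵥ (f : ℝ → Fin n ⊕ Fin n → ℂ) x
        = S.H x *ᵥ (g : ℝ → Fin n ⊕ Fin n → ℂ) x := by
  refine ⟨fun h => ?_, fun h => S.mk_eq_mk_of_ae f.2 g.2 h⟩
  filter_upwards [S.ae_mulVec_eq_zero (f.2.1.sub g.2.1) (S.sqNorm_sub_eq_zero h rfl)] with x hx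
  rwa [Pi.sub_apply, mulVec_sub, sub_eq_zero] at hx

/-- A representative of an element of `L²_H(0, ∞)`. -/
def rep (p : S.L2) : S.preL2 := (Submodule.Quotient.mk_surjective _ p).choose

@[simp] lemma mk_rep (p : S.L2) : Submodule.Quotient.mk (S.rep p) = p :=
  (Submodule.Quotient.mk_surjective _ p).choose_spec

/-- The Hilbert space `L²_H(0, ∞)`: the type `L2` equipped with its norm. -/
def Hilb : Type := S.L2

instance : AddCommGroup S.Hilb := inferInstanceAs (AddCommGroup S.L2)

instance : Module ℂ S.Hilb := inferInstanceAs (Module ℂ S.L2)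

/-- The class in `L²_H(0, ∞)` of a square integrable function, as a linear map. -/
def toHilb : S.preL2 →ₗ[ℂ] S.Hilb := S.nullL2.mkQ

lemma toHilb_rep (p : S.Hilb) : S.toHilb (S.rep p) = p := S.mk_rep p

lemma toHilb_eq_iff {f g : S.preL2} :
    S.toHilb f = S.toHilb g ↔
      ∀ᵐ x ∂volume.restrict (Ioi 0), S.H x *ᵥ (f : ℝ → Fin n ⊕ Fin n → ℂ) x
        = S.H x *ᵥ (g : ℝ → Fin n ⊕ Fin n → ℂ) x :=
  S.mk_eq_mk_iff

lemma pairing_rep (f g : S.preL2) :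
    S.pairing (S.rep (S.toHilb f)) (S.rep (S.toHilb g)) = S.pairing f g :=
  S.pairing_congr (S.toHilb_eq_iff.1 (S.toHilb_rep _)) (S.toHilb_eq_iff.1 (S.toHilb_rep _))

/-- The inner product of `L²_H(0, ∞)`. -/
@[reducible]
def innerCore : InnerProductSpace.Core ℂ S.Hilb where
  inner p q := S.pairing (S.rep p) (S.rep q)
  conj_inner_symm p q := S.pairing_star _ _
  re_inner_nonneg p := by
    change 0 ≤ (S.pairing (S.rep p) (S.rep p)).re
    rw [S.pairing_self_re _ (S.rep p).2]
    exact ENNReal.toReal_nonneg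
  add_left p q r := by
    obtain ⟨f, rfl⟩ : ∃ f, S.toHilb f = p := ⟨_, S.toHilb_rep p⟩
    obtain ⟨g, rfl⟩ : ∃ f, S.toHilb f = q := ⟨_, S.toHilb_rep q⟩
    obtain ⟨h, rfl⟩ : ∃ f, S.toHilb f = r := ⟨_, S.toHilb_rep r⟩
    rw [← map_add]
    simp only [pairing_rep]
    rw [← S.pairing_star, Submodule.coe_add, S.pairing_add_right h.2 f.2 g.2, star_add,
      S.pairing_star, S.pairing_star]
  smul_left p q c := by
    obtain ⟨f, rfl⟩ : ∃ f, S.toHilb f = p := ⟨_, S.toHilb_rep p⟩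
    obtain ⟨g, rfl⟩ : ∃ f, S.toHilb f = q := ⟨_, S.toHilb_rep q⟩
    rw [← map_smul]
    simp only [pairing_rep]
    rw [← S.pairing_star, Submodule.coe_smul, S.pairing_smul_right, star_mul', S.pairing_star]
    rfl
  definite p hp := by
    have h : S.sqNorm (S.rep p) = 0 := by
      have h1 := S.pairing_self_re _ (S.rep p).2
      rw [hp, Complex.zero_re] at h1
      exact ((ENNReal.toReal_eq_zero_iff _).1 h1.symm).resolve_right (S.rep p).2.2.ne
    rw [← S.toHilb_rep p]
    exact (Submodule.Quotient.mk_eq_zero S.nullL2).2 h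

instance : NormedAddCommGroup S.Hilb :=
  @InnerProductSpace.Core.toNormedAddCommGroup ℂ S.Hilb _ _ _ S.innerCore

instance : InnerProductSpace ℂ S.Hilb := InnerProductSpace.ofCore S.innerCore.toCore

lemma inner_toHilb (f g : S.preL2) :
    inner ℂ (S.toHilb f) (S.toHilb g) = S.pairing f g := S.pairing_rep f g

lemma norm_toHilb_sq (f : S.preL2) : ‖S.toHilb f‖ ^ 2 = (S.sqNorm f).toReal := by
  rw [← S.pairing_self_re f f.2, ← S.inner_toHilb, inner_self_eq_norm_sq_to_K]
  norm_cast

/-! ### Completeness -/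

/-- The pointwise half of Fatou's lemma when only `H a` converges: `a* H a ≥ 2 Re (b* H a) - b* H
b`, and the right side depends on `a` only through `H a`. -/
lemma density_le_liminf {a : ℕ → Fin n ⊕ Fin n → ℂ} {b : Fin n ⊕ Fin n → ℂ} {x : ℝ}
    (hx : (S.H x).PosSemidef)
    (h : Tendsto (fun m => S.H x *ᵥ a m) atTop (𝓝 (S.H x *ᵥ b))) :
    ENNReal.ofReal (star b ⬝ᵥ (S.H x *ᵥ b)).re
      ≤ liminf (fun m => ENNReal.ofReal (star (a m) ⬝ᵥ (S.H x *ᵥ a m)).re) atTop := by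
  have hc : Continuous fun v : Fin n ⊕ Fin n → ℂ =>
      ENNReal.ofReal (2 * (star b ⬝ᵥ v).re - (star b ⬝ᵥ (S.H x *ᵥ b)).re) := by
    refine ENNReal.continuous_ofReal.comp ?_
    unfold dotProduct
    fun_prop
  have ht := (hc.tendsto _).comp h
  have he : 2 * (star b ⬝ᵥ (S.H x *ᵥ b)).re - (star b ⬝ᵥ (S.H x *ᵥ b)).re
      = (star b ⬝ᵥ (S.H x *ᵥ b)).re := by ring
  rw [he] at ht
  rw [← ht.liminf_eq]
  refine liminf_le_liminf (Eventually.of_forall fun m => ENNReal.ofReal_le_ofReal ?_)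
  have h1 := hx.two_mul_norm_dotProduct_mulVec_le b (a m)
  have h2 := Complex.re_le_norm (star b ⬝ᵥ (S.H x *ᵥ a m))
  linarith

end CanonicalSystem
end

noncomputable section

/-- Cauchy–Schwarz of `2 ^ k` times the increment against the basis vectors bounds the increments of
`A a` by a multiple of `2⁻ᵏ`. The limit is of the form `A w` because the range of `A` is closed; the
vectors `a k` themselves need not converge. -/
lemma Matrix.PosSemidef.exists_tendsto_mulVec {ι : Type*} [Fintype ι] [DecidableEq ι]
    {A : Matrix ι ι ℂ}
    (hA : A.PosSemidef) {a : ℕ → ι → ℂ} {C : ℝ}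
    (h : ∀ k, 4 ^ k * (star (a (k + 1) - a k) ⬝ᵥ (A *ᵥ (a (k + 1) - a k))).re ≤ C) :
    ∃ w, Tendsto (fun k => A *ᵥ a k) atTop (𝓝 (A *ᵥ w)) := by
  classical
  have hcauchy : CauchySeq fun k => A *ᵥ a k := by
    have hi : ∀ i, 0 ≤ (A i i).re := fun i => (Complex.le_def.1 hA.diag_nonneg).1
    refine cauchySeq_of_le_geometric (1 / 2) ((∑ i, (A i i).re + C) / 2) (by norm_num) fun k => ?_
    have hb : ∀ i, 2 ^ k * ‖(A *ᵥ (a (k + 1) - a k)) i‖ ≤ (∑ i, (A i i).re + C) / 2 := by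
      intro i
      have h1 := hA.two_mul_norm_dotProduct_mulVec_le (Pi.single i 1)
        ((2 ^ k : ℂ) • (a (k + 1) - a k))
      have hs : star (Pi.single i (1 : ℂ) : ι → ℂ) = Pi.single i 1 := by
        rw [← Pi.single_star, star_one]
      have h4 : (star (2 ^ k : ℂ) * ((2 : ℂ) ^ k)) = ((4 ^ k : ℝ) : ℂ) := by
        rw [star_pow, star_ofNat, ← mul_pow]
        push_cast
        norm_num
      rw [star_smul, mulVec_smul, dotProduct_smul, dotProduct_smul, smul_dotProduct, smul_smul,
        mul_comm ((2 : ℂ) ^ k), h4, smul_eq_mul, smul_eq_mul, Complex.re_ofReal_mul, norm_mul,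
        hs, single_dotProduct, single_dotProduct, one_mul, one_mul] at h1
      have h2 : (A *ᵥ Pi.single i 1) i = A i i := by simp
      rw [h2, norm_pow, Complex.norm_ofNat] at h1
      have h3 := h k
      have h5 : (A i i).re ≤ ∑ i, (A i i).re :=
        Finset.single_le_sum (f := fun i => (A i i).re) (fun i _ => hi i) (Finset.mem_univ i)
      linarith
    rw [dist_comm, dist_eq_norm, ← mulVec_sub, one_div, inv_pow, ← div_eq_mul_inv,
      le_div_iff₀' (by positivity)]
    -- Without indices, no component shows that the bound is nonnegative; `h` at `0` then gives `0 ≤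
    -- C`.
    rcases isEmpty_or_nonempty ι with hι | ⟨⟨i⟩⟩
    · have hC := h 0
      simp only [dotProduct, Finset.univ_eq_empty, Finset.sum_empty, Complex.zero_re, mul_zero]
        at hC
      simpa [Subsingleton.elim (A *ᵥ (a (k + 1) - a k)) 0] using div_nonneg hC zero_le_two
    · rw [← le_div_iff₀' (by positivity), pi_norm_le_iff_of_nonneg
        (div_nonneg ((by positivity : (0:ℝ) ≤ _).trans (hb i)) (by positivity))]
      exact fun i => (le_div_iff₀' (by positivity)).2 (hb i)
  obtain ⟨η, hη⟩ := cauchySeq_tendsto_of_complete hcauchy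
  have hcl : IsClosed (LinearMap.range A.mulVecLin : Set (ι → ℂ)) :=
    Submodule.closed_of_finiteDimensional _
  obtain ⟨w, hw⟩ := hcl.mem_of_tendsto hη (Eventually.of_forall fun k => ⟨a k, rfl⟩)
  exact ⟨w, by rw [← mulVecLin_apply, hw]; exact hη⟩

namespace CanonicalSystem

variable {n : ℕ} (S : CanonicalSystem n)

/-- A limit, with respect to `H`, of a pointwise convergent sequence can be chosen measurably. -/
lemma exists_aemeasurable_tendsto {f : ℕ → ℝ → Fin n ⊕ Fin n → ℂ}
    (hf : ∀ k, AEMeasurable (f k) (volume.restrict (Ioi 0)))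
    (h : ∀ᵐ x ∂volume.restrict (Ioi 0),
      ∃ w, Tendsto (fun k => S.H x *ᵥ f k x) atTop (𝓝 (S.H x *ᵥ w))) :
    ∃ g : ℝ → Fin n ⊕ Fin n → ℂ, AEMeasurable g (volume.restrict (Ioi 0)) ∧
      ∀ᵐ x ∂volume.restrict (Ioi 0),
        Tendsto (fun k => S.H x *ᵥ f k x) atTop (𝓝 (S.H x *ᵥ g x)) := by
  classical
  let R : ℕ → ℝ → Matrix (Fin n ⊕ Fin n) (Fin n ⊕ Fin n) ℂ := fun m x =>
    (S.H x + ((1 / ((m : ℝ) + 1) : ℝ) : ℂ) • (1 : Matrix _ _ ℂ))⁻¹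
  have hR : ∀ m i j, AEMeasurable (fun x => R m x i j) (volume.restrict (Ioi 0)) := by
    intro m i j
    have h1 : AEMeasurable (fun x i j => S.H x i j +
        (((1 / ((m : ℝ) + 1) : ℝ) : ℂ) • (1 : Matrix (Fin n ⊕ Fin n) (Fin n ⊕ Fin n) ℂ)) i j)
        (volume.restrict (Ioi 0)) :=
      aemeasurable_pi_lambda _ fun i => aemeasurable_pi_lambda _ fun j =>
        (S.aestronglyMeasurable_H i j).aemeasurable.add_const _
    exact (measurable_matrix_inv_apply i j).comp_aemeasurable h1
  have hmul : ∀ (m : ℕ) (g : ℝ → Fin n ⊕ Fin n → ℂ), AEMeasurable g (volume.restrict (Ioi 0)) →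
      AEMeasurable (fun x => R m x *ᵥ g x) (volume.restrict (Ioi 0)) := by
    intro m g hg
    refine aemeasurable_pi_lambda _ fun i => ?_
    simp only [mulVec, dotProduct]
    exact Finset.aemeasurable_fun_sum _ fun j _ => (hR m i j).mul
      ((measurable_pi_apply j).comp_aemeasurable hg)
  -- The second condition makes `p` a function of `H p`, as the limit of the regularized inverses.
  -- So the pointwise choice below is forced, and `g` is measurable as a limit of measurable
  -- functions.
  let P : ℝ → (Fin n ⊕ Fin n → ℂ) → Prop := fun x p =>
    Tendsto (fun k => S.H x *ᵥ f k x) atTop (𝓝 (S.H x *ᵥ p)) ∧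
      Tendsto (fun m => R m x *ᵥ (S.H x *ᵥ p)) atTop (𝓝 p)
  let g : ℝ → Fin n ⊕ Fin n → ℂ := fun x => if hx : ∃ p, P x p then hx.choose else 0
  have hg : ∀ᵐ x ∂volume.restrict (Ioi 0), P x (g x) := by
    filter_upwards [h, S.posSemidef] with x ⟨w, hw⟩ hp
    have hx : ∃ p, P x p := by
      obtain ⟨p, hp1, hp2⟩ := hp.exists_tendsto_inv_mulVec w
      refine ⟨p, ?_, ?_⟩
      · rwa [hp1]
      · rwa [hp1]
    simp only [g, dif_pos hx]
    exact hx.choose_spec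
  have hHg : AEMeasurable (fun x => S.H x *ᵥ g x) (volume.restrict (Ioi 0)) :=
    aemeasurable_of_tendsto_metrizable_ae atTop (fun k => S.aemeasurable_mulVec (hf k))
      (hg.mono fun x hx => hx.1)
  exact ⟨g, aemeasurable_of_tendsto_metrizable_ae atTop (fun m => hmul m _ hHg)
    (hg.mono fun x hx => hx.2), hg.mono fun x hx => hx.1⟩

/-- Pointwise convergence of a rapidly Cauchy sequence. -/
lemma ae_exists_tendsto {f : ℕ → S.preL2}
    (h : ∀ k, S.sqNorm (f (k + 1) - f k : S.preL2) ≤ ENNReal.ofReal ((1 / 16) ^ k)) :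
    ∀ᵐ x ∂volume.restrict (Ioi 0), ∃ w, Tendsto
      (fun k => S.H x *ᵥ (f k : ℝ → Fin n ⊕ Fin n → ℂ) x) atTop (𝓝 (S.H x *ᵥ w)) := by
  have hm : ∀ k, AEMeasurable (fun x => ENNReal.ofReal (4 ^ k) *
      S.density (f (k + 1) - f k : S.preL2) x) (volume.restrict (Ioi 0)) := fun k =>
    (S.aemeasurable_density (f (k + 1) - f k : S.preL2).2.1).const_mul _
  -- The weights `4 ^ k` leave a summable `4⁻ᵏ` out of `16⁻ᵏ`, so almost everywhere the weighted
  -- densities have a finite sum, which bounds each of them.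
  have hle : ∀ k, ∫⁻ x in Ioi 0, ENNReal.ofReal (4 ^ k) *
      S.density (f (k + 1) - f k : S.preL2) x ≤ ENNReal.ofReal ((1 / 4) ^ k) := by
    intro k
    rw [lintegral_const_mul' _ _ ENNReal.ofReal_ne_top]
    refine (mul_le_mul_right (h k) _).trans ?_
    rw [← ENNReal.ofReal_mul (by positivity), ← mul_pow]
    norm_num
  have hfin : ∫⁻ x in Ioi 0, ∑' k, ENNReal.ofReal (4 ^ k) *
      S.density (f (k + 1) - f k : S.preL2) x ≠ ∞ := by
    rw [lintegral_tsum hm]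
    refine ((ENNReal.tsum_le_tsum hle).trans_lt ?_).ne
    rw [← ENNReal.ofReal_tsum_of_nonneg (fun k => by positivity)
      (summable_geometric_of_lt_one (by norm_num) (by norm_num))]
    exact ENNReal.ofReal_lt_top
  filter_upwards [ae_lt_top' (AEMeasurable.tsum hm) hfin, S.posSemidef] with x hx hp
  refine hp.exists_tendsto_mulVec
    (C := (∑' k, ENNReal.ofReal (4 ^ k) * S.density (f (k + 1) - f k : S.preL2) x).toReal)
    fun k => ?_
  rw [← ENNReal.ofReal_le_iff_le_toReal hx.ne, ENNReal.ofReal_mul (by positivity)]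
  exact ENNReal.le_tsum (f := fun k => ENNReal.ofReal (4 ^ k) *
    S.density (f (k + 1) - f k : S.preL2) x) k

/-- Riesz–Fischer for a degenerate weight: along a rapidly Cauchy sequence `H f` converges
pointwise, a measurable limit is selected, and Fatou gives convergence in norm. The rate `4⁻ᵏ` for
norms is `16⁻ᵏ` for squared norms. -/
instance : CompleteSpace S.Hilb := by
  refine Metric.complete_of_convergent_controlled_sequences (fun k => (1 / 4) ^ k)
    (fun k => by positivity) fun u hu => ?_
  have hsq : ∀ N k m, N ≤ k → N ≤ m →
      S.sqNorm (S.rep (u k) - S.rep (u m) : S.preL2) ≤ ENNReal.ofReal ((1 / 16) ^ N) := by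
    intro N k m hk hm
    have h1 := S.norm_toHilb_sq (S.rep (u k) - S.rep (u m))
    rw [map_sub, S.toHilb_rep, S.toHilb_rep] at h1
    have h2 := hu N k m hk hm
    rw [dist_eq_norm] at h2
    rw [← ENNReal.ofReal_toReal (S.rep (u k) - S.rep (u m)).2.2.ne, ← h1]
    refine ENNReal.ofReal_le_ofReal ?_
    calc _ ≤ ((1 / 4 : ℝ) ^ N) ^ 2 := pow_le_pow_left₀ (norm_nonneg _) h2.le 2
      _ = _ := by rw [← pow_mul, mul_comm, pow_mul]; norm_num
  obtain ⟨g, hgm, hg⟩ := S.exists_aemeasurable_tendsto (f := fun k => S.rep (u k))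
    (fun k => (S.rep (u k)).2.1)
    (S.ae_exists_tendsto (f := fun k => S.rep (u k)) fun k => hsq k _ _ (Nat.le_succ k) le_rfl)
  have hlim : ∀ k, S.sqNorm ((S.rep (u k) : ℝ → Fin n ⊕ Fin n → ℂ) - g)
      ≤ ENNReal.ofReal ((1 / 16) ^ k) := by
    intro k
    calc S.sqNorm ((S.rep (u k) : ℝ → Fin n ⊕ Fin n → ℂ) - g)
        ≤ ∫⁻ x in Ioi 0, liminf (fun m => S.density (S.rep (u k) - S.rep (u m) : S.preL2) x)
            atTop := by
          refine lintegral_mono_ae ?_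
          filter_upwards [hg, S.posSemidef] with x hx hp
          refine S.density_le_liminf hp ?_
          simp only [Submodule.coe_sub, Pi.sub_apply, mulVec_sub]
          exact tendsto_const_nhds.sub hx
      _ ≤ liminf (fun m => S.sqNorm (S.rep (u k) - S.rep (u m) : S.preL2)) atTop :=
          lintegral_liminf_le' fun m => S.aemeasurable_density (S.rep (u k) - S.rep (u m)).2.1
      _ ≤ liminf (fun _ : ℕ => ENNReal.ofReal ((1 / 16) ^ k)) atTop :=
          liminf_le_liminf (by
            filter_upwards [eventually_ge_atTop k] with m hm using hsq k k m le_rfl hm)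
      _ = _ := liminf_const _
  have hg2 : g ∈ S.preL2 := by
    have h1 : (S.rep (u 0) : ℝ → Fin n ⊕ Fin n → ℂ) - g ∈ S.preL2 :=
      ⟨(S.rep (u 0)).2.1.sub hgm, (hlim 0).trans_lt ENNReal.ofReal_lt_top⟩
    simpa using S.preL2.sub_mem (S.rep (u 0)).2 h1
  refine ⟨S.toHilb ⟨g, hg2⟩, ?_⟩
  rw [tendsto_iff_norm_sub_tendsto_zero]
  refine squeeze_zero (fun k => norm_nonneg _) (g := fun k : ℕ => (1 / 4 : ℝ) ^ k) (fun k => ?_)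
    (tendsto_pow_atTop_nhds_zero_of_lt_one (by norm_num) (by norm_num))
  refine le_of_sq_le_sq ?_ (by positivity)
  have h1 := S.norm_toHilb_sq (S.rep (u k) - ⟨g, hg2⟩)
  rw [map_sub, S.toHilb_rep] at h1
  rw [h1]
  refine (ENNReal.toReal_le_of_le_ofReal (by positivity) (hlim k)).trans (le_of_eq ?_)
  rw [← pow_mul, mul_comm, pow_mul]
  norm_num

end CanonicalSystem
end

noncomputable section

/-! ### Linear relations in a Hilbert space -/

namespace LinearRelation

variable {E : Type*} [NormedAddCommGroup E] [InnerProductSpace ℂ E]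

/-- The boundary form `⟪g, h⟫ - ⟪f, k⟫` of two pairs `(f, g)` and `(h, k)`. -/
def form (p q : E × E) : ℂ := inner ℂ p.2 q.1 - inner ℂ p.1 q.2

lemma star_form (p q : E × E) : star (form p q) = -form q p := by
  simp only [form, star_sub, Complex.star_def, inner_conj_symm, neg_sub]

lemma form_add_left (p p' q : E × E) : form (p + p') q = form p q + form p' q := by
  simp only [form, Prod.fst_add, Prod.snd_add, inner_add_left]
  ring

lemma form_smul_left (c : ℂ) (p q : E × E) : form (c • p) q = star c * form p q := by
  simp only [form, Prod.smul_fst, Prod.smul_snd, inner_smul_left, Complex.star_def]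
  ring

lemma form_defect_self (z : ℂ) (a : E) :
    form (a, z • a) (a, z • a) = (star z - z) * (‖a‖ : ℂ) ^ 2 := by
  simp only [form, inner_smul_left, inner_smul_right, inner_self_eq_norm_sq_to_K,
    Complex.star_def, Complex.coe_algebraMap]
  ring

/-- The part of `T` on which the boundary form vanishes against all of `T`. -/
def radical (T : Submodule ℂ (E × E)) : Submodule ℂ (E × E) where
  carrier := {p | p ∈ T ∧ ∀ q ∈ T, form p q = 0}
  zero_mem' := ⟨T.zero_mem, fun q _ => by simp [form]⟩
  add_mem' := fun hp hq => ⟨T.add_mem hp.1 hq.1, fun r hr => by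
    rw [form_add_left, hp.2 r hr, hq.2 r hr, add_zero]⟩
  smul_mem' := fun c p hp => ⟨T.smul_mem c hp.1, fun r hr => by
    rw [form_smul_left, hp.2 r hr, mul_zero]⟩

/-- The defect space `ker (T - z)`. -/
def defect (T : Submodule ℂ (E × E)) (z : ℂ) : Submodule ℂ E :=
  T.comap (LinearMap.id.prod (z • LinearMap.id))

lemma mem_defect {T : Submodule ℂ (E × E)} {z : ℂ} {a : E} :
    a ∈ defect T z ↔ (a, z • a) ∈ T := Iff.rfl

variable {T : Submodule ℂ (E × E)}

lemma continuous_form_left (q : E × E) : Continuous fun p : E × E => form p q := by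
  unfold form
  fun_prop

lemma continuous_form_right (p : E × E) : Continuous fun q : E × E => form p q := by
  unfold form
  fun_prop

/-- The assumption `hT` says that the adjoint of the radical lies in `T`; it expresses the radical
by vanishing conditions for continuous functions alone. -/
lemma isClosed_radical (hT : ∀ q, (∀ p ∈ radical T, form p q = 0) → q ∈ T) :
    IsClosed (radical T : Set (E × E)) := by
  have h : (radical T : Set (E × E)) =
      (⋂ p ∈ radical T, {q | form p q = 0}) ∩ ⋂ q ∈ T, {p | form p q = 0} := by
    ext r
    simp only [SetLike.mem_coe, mem_inter_iff, mem_iInter, mem_ofPred_eq]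
    exact ⟨fun hr => ⟨fun p hp => hp.2 r hr.1, hr.2⟩, fun hr => ⟨hT r hr.1, hr.2⟩⟩
  rw [h]
  exact (isClosed_biInter fun p _ => isClosed_eq (continuous_form_right p) continuous_const).inter
    (isClosed_biInter fun q _ => isClosed_eq (continuous_form_left q) continuous_const)

/-- The operator `(f, g) ↦ g + i f` on pairs. -/
def shift (E : Type*) [NormedAddCommGroup E] [InnerProductSpace ℂ E] : E × E →ₗ[ℂ] E :=
  LinearMap.snd ℂ E E + Complex.I • LinearMap.fst ℂ E E

lemma shift_apply (p : E × E) : shift E p = p.2 + Complex.I • p.1 := rfl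

/-- If the form vanishes at `p`, then `⟪p.2, p.1⟫` is real, so the cross term in the expansion is
purely imaginary. -/
lemma norm_shift_sq {p : E × E} (hp : form p p = 0) :
    ‖shift E p‖ ^ 2 = ‖p.2‖ ^ 2 + ‖p.1‖ ^ 2 := by
  have h : (inner ℂ p.2 (Complex.I • p.1)).re = 0 := by
    have h1 : inner ℂ p.2 p.1 = star (inner ℂ p.2 p.1) := by
      rw [Complex.star_def, inner_conj_symm]
      exact sub_eq_zero.1 hp
    have h2 : (inner ℂ p.2 p.1).im = 0 := Complex.conj_eq_iff_im.1 h1.symm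
    rw [inner_smul_right, Complex.mul_re, h2]
    simp
  have h3 := norm_add_sq (𝕜 := ℂ) p.2 (Complex.I • p.1)
  rw [shift_apply, h3, show RCLike.re (inner ℂ p.2 (Complex.I • p.1)) = 0 from h, norm_smul,
    Complex.norm_I, one_mul, mul_zero, add_zero]

variable [CompleteSpace E]

/-- On the closed radical, `shift` is bounded below by `norm_shift_sq`, hence has closed range. -/
lemma isClosed_map_shift (hT : ∀ q, (∀ p ∈ radical T, form p q = 0) → q ∈ T) :
    IsClosed ((radical T).map (shift E) : Set E) := by
  have : CompleteSpace (radical T) := (isClosed_radical hT).completeSpace_coe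
  let f : radical T →ₗ[ℂ] E := (shift E).comp (radical T).subtype
  have hf : AntilipschitzWith 1 f := by
    refine AddMonoidHomClass.antilipschitz_of_bound f fun x => ?_
    have h := norm_shift_sq (x.2.2 _ x.2.1)
    change ‖(x : E × E)‖ ≤ _ * ‖shift E x‖
    rw [NNReal.coe_one, one_mul, Prod.norm_def]
    exact max_le (abs_le_of_sq_le_sq' (by nlinarith [sq_nonneg ‖(x : E × E).2‖]) (norm_nonneg _)).2
      (abs_le_of_sq_le_sq' (by nlinarith [sq_nonneg ‖(x : E × E).1‖]) (norm_nonneg _)).2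
  have hu : Continuous f := by
    change Continuous fun x : radical T => (x : E × E).2 + Complex.I • (x : E × E).1
    fun_prop
  have hc := hf.isClosed_range (f := f)
    (f.toAddMonoidHom.uniformContinuous_of_continuousAt_zero hu.continuousAt)
  convert! hc using 1
  ext y
  simp [f]

/-- **von Neumann's formula** for a relation containing the adjoint of its radical. -/
theorem exists_eq_add (hT : ∀ q, (∀ p ∈ radical T, form p q = 0) → q ∈ T) {p : E × E}
    (hp : p ∈ T) : ∃ r ∈ radical T, ∃ a ∈ defect T Complex.I, ∃ b ∈ defect T (-Complex.I),
      p = r + (a, Complex.I • a) + (b, (-Complex.I) • b) := by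
  have : CompleteSpace ((radical T).map (shift E)) := (isClosed_map_shift hT).completeSpace_coe
  obtain ⟨k, ⟨r, hr, rfl⟩, h, hh, hw⟩ :=
    ((radical T).map (shift E)).exists_add_mem_mem_orthogonal (shift E p)
  -- Orthogonality to the range of `g + i f` on the radical says that `(h, i h)` is in the adjoint
  -- of the radical.
  have hdef : h ∈ defect T Complex.I := by
    refine hT _ fun q hq => ?_
    have := hh _ (Submodule.mem_map_of_mem hq)
    rw [shift_apply, inner_add_left, inner_smul_left, Complex.conj_I] at this
    change inner ℂ q.2 h - inner ℂ q.1 (Complex.I • h) = 0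
    rw [inner_smul_right]
    linear_combination this
  -- The factor is chosen so that `shift` sends `(a, i a)` to `2 i a = h`. What remains of `p` is
  -- killed by `shift`, so it has the form `(b, -i b)`.
  set a : E := (-Complex.I / 2) • h with ha
  have haT : a ∈ defect T Complex.I := Submodule.smul_mem _ _ hdef
  have hp' : p - r - (a, Complex.I • a) ∈ T := T.sub_mem (T.sub_mem hp hr.1) haT
  have hs : (p - r - (a, Complex.I • a)).2 = (-Complex.I) • (p - r - (a, Complex.I • a)).1 := by
    have h1 : Complex.I • a + Complex.I • a = h := by
      rw [← two_smul ℂ, ha, smul_smul, smul_smul]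
      convert one_smul ℂ h
      linear_combination (-1 : ℂ) * Complex.I_mul_I
    rw [shift_apply, shift_apply, ← h1] at hw
    simp only [Prod.snd_sub, Prod.fst_sub, neg_smul, smul_sub]
    rw [← sub_eq_zero] at hw ⊢
    rw [← hw]
    abel
  refine ⟨r, hr, a, haT, (p - r - (a, Complex.I • a)).1, ?_, ?_⟩
  · rw [mem_defect, ← hs]
    exact hp'
  · rw [← hs, Prod.mk.eta]
    abel

end LinearRelation

end

noncomputable section

/-! ### The symplectic form on `ℂ²ⁿ` -/

lemma symplJ_mulVec_mulVec {n : ℕ} (v : Fin n ⊕ Fin n → ℂ) :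
    symplJ n *ᵥ (symplJ n *ᵥ v) = -v := by
  rw [mulVec_mulVec, Matrix.J_squared, neg_mulVec, one_mulVec]

lemma star_symplJ_mulVec_dotProduct {n : ℕ} (v w : Fin n ⊕ Fin n → ℂ) :
    star (symplJ n *ᵥ v) ⬝ᵥ w = -(star v ⬝ᵥ (symplJ n *ᵥ w)) := by
  have h : (symplJ n)ᴴ = -symplJ n := by
    rw [conjTranspose, Matrix.J_transpose]
    ext i j
    rcases i with i | i <;> rcases j with j | j <;> simp [Matrix.J, Matrix.one_apply, apply_ite]
  rw [star_mulVec, h, ← dotProduct_mulVec, neg_mulVec, dotProduct_neg]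

/-- For `z = ± i` this exhibits an `n`-dimensional subspace on which `v* J v` is a nonnegative
multiple of `-2z`, the same sign as `form` has on `ker (T - z)` by `form_defect_self`. -/
lemma star_dotProduct_symplJ_mulVec_self {n : ℕ} {z : ℂ} (hz : star z = -z)
    {v : Fin n ⊕ Fin n → ℂ} (hv : ∀ i, v (Sum.inr i) = z * v (Sum.inl i)) :
    star v ⬝ᵥ (symplJ n *ᵥ v) = -2 * z * ∑ i, ((‖v (Sum.inl i)‖ ^ 2 : ℝ) : ℂ) := by
  have h1 : symplJ n *ᵥ v = Sum.elim (fun i => -v (Sum.inr i)) (fun i => v (Sum.inl i)) := by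
    ext i
    rcases i with i | i <;>
      simp [Matrix.J, mulVec, dotProduct, Fintype.sum_sum_type, Matrix.one_apply]
  rw [h1, dotProduct, Fintype.sum_sum_type, ← Finset.sum_add_distrib, Finset.mul_sum]
  refine Finset.sum_congr rfl fun i _ => ?_
  have h2 : ((‖v (Sum.inl i)‖ ^ 2 : ℝ) : ℂ) = star (v (Sum.inl i)) * v (Sum.inl i) := by
    rw [Complex.star_def, ← Complex.normSq_eq_conj_mul_self, Complex.normSq_eq_norm_sq]
  rw [h2]
  simp only [Sum.elim_inl, Sum.elim_inr, Pi.star_apply, hv, star_mul', hz]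
  ring

/-! ### Defect numbers and an abstract boundary map -/

namespace LinearRelation

variable {E : Type*} [NormedAddCommGroup E] [InnerProductSpace ℂ E] {T : Submodule ℂ (E × E)}
  {n : ℕ} (δ : T →ₗ[ℂ] (Fin n ⊕ Fin n → ℂ))

/-- The boundary form at infinity, in terms of a boundary map `δ` at the left endpoint. -/
def boundaryForm (p q : T) : ℂ :=
  star (δ p) ⬝ᵥ (symplJ n *ᵥ δ q) + form (p : E × E) q

/-- A defect vector `a ∈ ker (T - z)`, as the element `(a, z a)` of `T`. -/
def defectPair (T : Submodule ℂ (E × E)) (z : ℂ) : defect T z →ₗ[ℂ] T :=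
  ((LinearMap.id.prod (z • LinearMap.id)).comp (defect T z).subtype).codRestrict T fun a => a.2

lemma coe_defectPair (z : ℂ) (a : defect T z) : (defectPair T z a : E × E) = ((a : E), z • (a : E)) := rfl

/-- The boundary values of the two defect spaces. -/
def defectBoundary : (defect T Complex.I × defect T (-Complex.I)) →ₗ[ℂ] (Fin n ⊕ Fin n → ℂ) :=
  (δ.comp (defectPair T Complex.I)).coprod (δ.comp (defectPair T (-Complex.I)))

variable {δ}

/-- Testing against an element with boundary value `J δ(p)` and vanishing boundary form leaves only
the squared length of `J δ(p)`. -/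
lemma map_eq_zero_of_mem_radical (hc : ∀ v, ∃ p, δ p = v ∧ ∀ q, boundaryForm δ p q = 0) {p : T}
    (hp : (p : E × E) ∈ radical T) : δ p = 0 := by
  obtain ⟨q, hq, hq0⟩ := hc (symplJ n *ᵥ δ p)
  have h1 := hq0 p
  have h2 : form (q : E × E) p = 0 := by
    have := star_form (p : E × E) q
    rw [hp.2 q q.2, star_zero] at this
    exact neg_eq_zero.1 this.symm
  rw [boundaryForm, h2, add_zero, hq] at h1
  have h3 : symplJ n *ᵥ δ p = 0 := dotProduct_star_self_eq_zero.1 h1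
  rw [← neg_eq_zero, ← symplJ_mulVec_mulVec, h3, mulVec_zero]

/-- A defect space at `± i` on which the boundary form at infinity vanishes is at most
`n`-dimensional. -/
lemma finrank_defect_le {z : ℂ} (hz : star z = -z) (hz0 : z ≠ 0)
    (h : ∀ a : defect T z, boundaryForm δ (defectPair T z a) (defectPair T z a) = 0) :
    Module.finrank ℂ (defect T z) ≤ n := by
  -- The kernel of `κ` consists of the defect vectors whose boundary value lies in the subspace `v₂
  -- = z v₁`. There both terms of the boundary form are nonnegative multiples of `-2z`, so both
  -- vanish.
  let κ : defect T z →ₗ[ℂ] (Fin n → ℂ) :=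
    (LinearMap.pi fun i => LinearMap.proj (Sum.inr i) - z • LinearMap.proj (Sum.inl i)).comp
      (δ.comp (defectPair T z))
  have hκ : Function.Injective κ := by
    refine (injective_iff_map_eq_zero κ).2 fun a ha => ?_
    have h1 := h a
    rw [boundaryForm, star_dotProduct_symplJ_mulVec_self hz fun i => ?_, coe_defectPair,
      form_defect_self, hz] at h1
    · have h2 : (-2 * z) * ((∑ i, ‖δ (defectPair T z a) (Sum.inl i)‖ ^ 2 + ‖(a : E)‖ ^ 2 : ℝ) : ℂ)
          = 0 := by
        push_cast
        push_cast at h1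
        linear_combination h1
      have h3 := (mul_eq_zero.1 h2).resolve_left (by simp [hz0])
      have h4 := Complex.ofReal_eq_zero.1 h3
      have h5 : 0 ≤ ∑ i, ‖δ (defectPair T z a) (Sum.inl i)‖ ^ 2 :=
        Finset.sum_nonneg fun i _ => sq_nonneg _
      have h6 : ‖(a : E)‖ ^ 2 = 0 := le_antisymm (by linarith) (sq_nonneg _)
      exact Subtype.ext (norm_eq_zero.1 (pow_eq_zero_iff two_ne_zero |>.1 h6))
    · exact sub_eq_zero.1 (congrFun ha i)
  simpa using LinearMap.finrank_le_finrank_of_injective hκ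

/-- With zero boundary value and `B = 0`, the sum of the two defect pairs is `form`-orthogonal to
all of `T`. Testing with each pair, the cross terms cancel and `∓ 2i` times a squared norm remains.
-/
lemma injective_defectBoundary (h0 : ∀ p q, boundaryForm δ p q = 0) :
    Function.Injective (defectBoundary δ) := by
  refine (injective_iff_map_eq_zero _).2 fun ⟨a, b⟩ hab => ?_
  have hx : ∀ q : T, form (defectPair T Complex.I a + defectPair T (-Complex.I) b : T) (q : E × E)
      = 0 := by
    intro q
    have h1 := h0 (defectPair T Complex.I a + defectPair T (-Complex.I) b) q
    have h2 : δ (defectPair T Complex.I a + defectPair T (-Complex.I) b) = 0 := by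
      rw [map_add]
      exact hab
    rwa [boundaryForm, h2, star_zero, zero_dotProduct, zero_add] at h1
  have ha := hx (defectPair T Complex.I a)
  have hb := hx (defectPair T (-Complex.I) b)
  simp only [form, Submodule.coe_add, coe_defectPair, Prod.fst_add, Prod.snd_add, inner_add_left,
    inner_smul_left, inner_smul_right, map_neg, Complex.conj_I] at ha hb
  have ha' : inner ℂ (a : E) (a : E) = 0 := by
    refine (mul_eq_zero.1 (?_ : (-2 * Complex.I) * inner ℂ (a : E) (a : E) = 0)).resolve_left
      (by simp)
    linear_combination ha
  have hb' : inner ℂ (b : E) (b : E) = 0 := by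
    refine (mul_eq_zero.1 (?_ : (2 * Complex.I) * inner ℂ (b : E) (b : E) = 0)).resolve_left
      (by simp)
    linear_combination hb
  exact Prod.ext (Subtype.ext (inner_self_eq_zero.1 ha')) (Subtype.ext (inner_self_eq_zero.1 hb'))

variable [CompleteSpace E]

lemma exists_sub_mem_radical (hT : ∀ q, (∀ p ∈ radical T, form p q = 0) → q ∈ T)
    (hc : ∀ v, ∃ p, δ p = v ∧ ∀ q, boundaryForm δ p q = 0) (p : T) :
    ∃ r : T, (r : E × E) ∈ radical T ∧ ∃ a b, p = r + defectPair T Complex.I a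
      + defectPair T (-Complex.I) b ∧ δ p = defectBoundary δ (a, b) := by
  obtain ⟨r, hr, a, ha, b, hb, h⟩ := exists_eq_add hT p.2
  have h' : p = ⟨r, hr.1⟩ + defectPair T Complex.I ⟨a, ha⟩ + defectPair T (-Complex.I) ⟨b, hb⟩ :=
    Subtype.ext h
  refine ⟨⟨r, hr.1⟩, hr, ⟨a, ha⟩, ⟨b, hb⟩, h', ?_⟩
  conv_lhs => rw [h']
  rw [map_add, map_add, map_eq_zero_of_mem_radical hc hr, zero_add]
  rfl

lemma surjective_defectBoundary (hT : ∀ q, (∀ p ∈ radical T, form p q = 0) → q ∈ T)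
    (hc : ∀ v, ∃ p, δ p = v ∧ ∀ q, boundaryForm δ p q = 0) :
    Function.Surjective (defectBoundary δ) := by
  intro v
  obtain ⟨p, hp, -⟩ := hc v
  obtain ⟨r, hr, a, b, -, h⟩ := exists_sub_mem_radical hT hc p
  exact ⟨(a, b), h.symm.trans hp⟩

/-- Modulo an element `s` with the same boundary value and vanishing boundary form, `p` has zero
boundary value; injectivity removes its defect components and leaves a radical element. -/
lemma boundaryForm_eq_zero_of_injective (hT : ∀ q, (∀ p ∈ radical T, form p q = 0) → q ∈ T)
    (hc : ∀ v, ∃ p, δ p = v ∧ ∀ q, boundaryForm δ p q = 0)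
    (hi : Function.Injective (defectBoundary δ)) (p q : T) : boundaryForm δ p q = 0 := by
  obtain ⟨s, hs, hs0⟩ := hc (δ p)
  obtain ⟨r, hr, a, b, h, hab⟩ := exists_sub_mem_radical hT hc (p - s)
  rw [map_sub, hs, sub_self] at hab
  obtain ⟨rfl, rfl⟩ := Prod.mk_eq_zero.1 (hi (hab.symm.trans (map_zero _).symm))
  rw [map_zero, map_zero, add_zero, add_zero] at h
  obtain rfl : p = r + s := by rw [← h, sub_add_cancel]
  have h1 := hs0 q
  rw [boundaryForm] at h1 ⊢
  rw [← hs, Submodule.coe_add, form_add_left, hr.2 q q.2, zero_add, h1]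

/-- The defect numbers of `T` at `± i` are both `n` if and only if the boundary form at infinity
vanishes. -/
theorem rank_defect_eq_iff (hT : ∀ q, (∀ p ∈ radical T, form p q = 0) → q ∈ T)
    (hc : ∀ v, ∃ p, δ p = v ∧ ∀ q, boundaryForm δ p q = 0) :
    (Module.rank ℂ (defect T Complex.I) = n ∧ Module.rank ℂ (defect T (-Complex.I)) = n) ↔
      ∀ p q, boundaryForm δ p q = 0 := by
  constructor
  · rintro ⟨h1, h2⟩
    have : FiniteDimensional ℂ (defect T Complex.I) :=
      Module.rank_lt_aleph0_iff.1 (h1 ▸ Cardinal.natCast_lt_aleph0)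
    have : FiniteDimensional ℂ (defect T (-Complex.I)) :=
      Module.rank_lt_aleph0_iff.1 (h2 ▸ Cardinal.natCast_lt_aleph0)
    refine boundaryForm_eq_zero_of_injective hT hc
      ((LinearMap.injective_iff_surjective_of_finrank_eq_finrank ?_).2
        (surjective_defectBoundary hT hc))
    rw [Module.finrank_prod, Module.finrank_eq_of_rank_eq h1, Module.finrank_eq_of_rank_eq h2]
    simp
  · intro h0
    have hi := injective_defectBoundary h0
    have : FiniteDimensional ℂ (defect T Complex.I × defect T (-Complex.I)) :=
      FiniteDimensional.of_injective _ hi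
    have : FiniteDimensional ℂ (defect T Complex.I) :=
      FiniteDimensional.of_injective (LinearMap.inl ℂ _ (defect T (-Complex.I)))
        LinearMap.inl_injective
    have : FiniteDimensional ℂ (defect T (-Complex.I)) :=
      FiniteDimensional.of_injective (LinearMap.inr ℂ (defect T Complex.I) _)
        LinearMap.inr_injective
    have hsum := (LinearEquiv.ofBijective _ ⟨hi, surjective_defectBoundary hT hc⟩).finrank_eq
    rw [Module.finrank_prod] at hsum
    simp only [Module.finrank_fintype_fun_eq_card, Fintype.card_sum, Fintype.card_fin] at hsum
    -- The dimensions add up to `2n`, so bounding each by `n` determines both.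
    have h1 := finrank_defect_le (δ := δ) (z := Complex.I) (by simp) (by simp) fun a => h0 _ _
    have h2 := finrank_defect_le (δ := δ) (z := -Complex.I) (by simp) (by simp) fun a => h0 _ _
    rw [← Module.finrank_eq_rank, ← Module.finrank_eq_rank, Nat.cast_inj, Nat.cast_inj]
    omega

end LinearRelation

end

noncomputable section

namespace CanonicalSystem

variable {n : ℕ} (S : CanonicalSystem n)

/-! ### Primitives -/

/-- The primitive `c + ∫₀ˣ J H g`, a solution of `J f' = -H g` with `f(0) = c`. -/
def prim (c : Fin n ⊕ Fin n → ℂ) (g : ℝ → Fin n ⊕ Fin n → ℂ) (x : ℝ) : Fin n ⊕ Fin n → ℂ :=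
  c + ∫ t in Ioc 0 x, symplJ n *ᵥ (S.H t *ᵥ g t)

variable {S}

lemma integrableOn_H (hreg : S.RegularAtZero) (b : ℝ) (i j : Fin n ⊕ Fin n) :
    IntegrableOn (fun x => S.H x i j) (Ioc 0 b) := by
  obtain ⟨c, hc, h⟩ := hreg
  have h1 : IntegrableOn (fun x => S.H x i j) (Icc (c / 2) b) :=
    (S.locallyIntegrable i j).integrableOn_compact_subset
      (fun x hx => (half_pos hc).trans_le hx.1) isCompact_Icc
  refine ((h i j).union h1).mono_set fun x hx => ?_
  rcases lt_or_ge x c with h | h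
  · exact Or.inl ⟨hx.1, h⟩
  · exact Or.inr ⟨by linarith, hx.2⟩

/-- Cauchy–Schwarz against the basis vectors gives `2 |(H g)ᵢ| ≤ Hᵢᵢ + g* H g`, and both terms are
integrable up to the regular endpoint. -/
lemma integrableOn_mulVec (hreg : S.RegularAtZero) {g : ℝ → Fin n ⊕ Fin n → ℂ} (hg : g ∈ S.preL2)
    (b : ℝ) : IntegrableOn (fun x => S.H x *ᵥ g x) (Ioc 0 b) := by
  have hle : volume.restrict (Ioc 0 b) ≤ volume.restrict (Ioi 0) :=
    Measure.restrict_mono Ioc_subset_Ioi_self le_rfl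
  refine Integrable.of_eval fun i => ?_
  have h1 := (integrableOn_H hreg b i i).re.add ((S.integrable_re_of_mem_preL2 hg).mono_measure hle)
  refine h1.mono' ((measurable_pi_apply i).comp_aemeasurable
    ((S.aemeasurable_mulVec hg.1).mono_measure hle)).aestronglyMeasurable ?_
  filter_upwards [ae_mono hle S.posSemidef] with x hx
  have h2 := hx.two_mul_norm_dotProduct_mulVec_le (Pi.single i 1) (g x)
  have hs : star (Pi.single i (1 : ℂ) : Fin n ⊕ Fin n → ℂ) = Pi.single i 1 := by
    rw [← Pi.single_star, star_one]
  have h3 : (S.H x *ᵥ Pi.single i 1) i = S.H x i i := by simp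
  rw [hs, single_dotProduct, single_dotProduct, one_mul, one_mul, h3] at h2
  have h4 := norm_nonneg ((S.H x *ᵥ g x) i)
  change _ ≤ (S.H x i i).re + _
  linarith

lemma integrableOn_symplJ_mulVec (hreg : S.RegularAtZero) {g : ℝ → Fin n ⊕ Fin n → ℂ}
    (hg : g ∈ S.preL2) (b : ℝ) :
    IntegrableOn (fun x => symplJ n *ᵥ (S.H x *ᵥ g x)) (Ioc 0 b) :=
  (LinearMap.toContinuousLinearMap (symplJ n).mulVecLin).integrable_comp
    (integrableOn_mulVec hreg hg b)

lemma intervalIntegrable_symplJ_mulVec (hreg : S.RegularAtZero) {g : ℝ → Fin n ⊕ Fin n → ℂ}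
    (hg : g ∈ S.preL2) {b : ℝ} (hb : 0 ≤ b) :
    IntervalIntegrable (fun x => symplJ n *ᵥ (S.H x *ᵥ g x)) volume 0 b :=
  (intervalIntegrable_iff_integrableOn_Ioc_of_le hb).2 (integrableOn_symplJ_mulVec hreg hg b)

lemma prim_of_nonpos (c : Fin n ⊕ Fin n → ℂ) (g : ℝ → Fin n ⊕ Fin n → ℂ) {x : ℝ} (hx : x ≤ 0) :
    S.prim c g x = c := by
  simp [prim, Ioc_eq_empty_of_le hx]

lemma prim_of_nonneg (c : Fin n ⊕ Fin n → ℂ) (g : ℝ → Fin n ⊕ Fin n → ℂ) {x : ℝ} (hx : 0 ≤ x) :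
    S.prim c g x = c + ∫ t in 0..x, symplJ n *ᵥ (S.H t *ᵥ g t) := by
  rw [prim, intervalIntegral.integral_of_le hx]

lemma prim_congr (c : Fin n ⊕ Fin n → ℂ) {g k : ℝ → Fin n ⊕ Fin n → ℂ}
    (h : ∀ᵐ x ∂volume.restrict (Ioi 0), S.H x *ᵥ g x = S.H x *ᵥ k x) :
    S.prim c g = S.prim c k := by
  ext1 x
  unfold prim
  congr 1
  refine integral_congr_ae ?_
  filter_upwards [ae_restrict_of_ae_restrict_of_subset Ioc_subset_Ioi_self h] with t ht
  rw [ht]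

lemma prim_eq_add (c : Fin n ⊕ Fin n → ℂ) (g : ℝ → Fin n ⊕ Fin n → ℂ) (x : ℝ) :
    S.prim c g x = c + S.prim 0 g x := by
  simp [prim]

lemma prim_add (hreg : S.RegularAtZero) (c d : Fin n ⊕ Fin n → ℂ) {g k : ℝ → Fin n ⊕ Fin n → ℂ}
    (hg : g ∈ S.preL2) (hk : k ∈ S.preL2) :
    S.prim (c + d) (g + k) = S.prim c g + S.prim d k := by
  ext1 x
  simp only [prim, Pi.add_apply, mulVec_add]
  rw [integral_add (integrableOn_symplJ_mulVec hreg hg x) (integrableOn_symplJ_mulVec hreg hk x)]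
  abel

lemma prim_smul (a : ℂ) (c : Fin n ⊕ Fin n → ℂ) (g : ℝ → Fin n ⊕ Fin n → ℂ) :
    S.prim (a • c) (a • g) = a • S.prim c g := by
  ext1 x
  simp only [prim, Pi.smul_apply, mulVec_smul, smul_add, integral_smul]

lemma absolutelyContinuous_prim (hreg : S.RegularAtZero) (c : Fin n ⊕ Fin n → ℂ)
    {g : ℝ → Fin n ⊕ Fin n → ℂ} (hg : g ∈ S.preL2) {b : ℝ} (hb : 0 ≤ b) :
    AbsolutelyContinuousOnInterval (S.prim c g) 0 b := by
  refine (intervalIntegrable_symplJ_mulVec hreg hg hb).absolutelyContinuousOnInterval_integral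
    |>.of_dist_le fun x hx y hy => ?_
  rw [uIcc_of_le hb] at hx hy
  rw [prim_of_nonneg c g hx.1, prim_of_nonneg c g hy.1, dist_add_left]

lemma ae_hasDerivAt_prim (hreg : S.RegularAtZero) (c : Fin n ⊕ Fin n → ℂ)
    {g : ℝ → Fin n ⊕ Fin n → ℂ} (hg : g ∈ S.preL2) :
    ∀ᵐ x ∂volume.restrict (Ioi 0),
      HasDerivAt (S.prim c g) (symplJ n *ᵥ (S.H x *ᵥ g x)) x := by
  rw [ae_restrict_iff' measurableSet_Ioi]
  have h : ∀ m : ℕ, ∀ᵐ x, x ∈ uIcc (0 : ℝ) m →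
      HasDerivAt (fun x => ∫ t in 0..x, symplJ n *ᵥ (S.H t *ᵥ g t)) (symplJ n *ᵥ (S.H x *ᵥ g x)) x :=
    fun m => (intervalIntegrable_symplJ_mulVec hreg hg
      (Nat.cast_nonneg m)).ae_hasDerivAt_integral.mono fun x hx hm => hx hm 0 left_mem_uIcc
  filter_upwards [ae_all_iff.2 h] with x hx hx0
  obtain ⟨m, hm⟩ := exists_nat_ge x
  have h1 := (hx m (by rw [uIcc_of_le (Nat.cast_nonneg m)]; exact ⟨le_of_lt hx0, hm⟩)).const_add c
  refine h1.congr_of_eventuallyEq ?_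
  filter_upwards [Ioi_mem_nhds hx0] with y hy
  exact prim_of_nonneg c g (le_of_lt hy)

lemma continuousOn_prim (hreg : S.RegularAtZero) (c : Fin n ⊕ Fin n → ℂ)
    {g : ℝ → Fin n ⊕ Fin n → ℂ} (hg : g ∈ S.preL2) {b : ℝ} (hb : 0 ≤ b) :
    ContinuousOn (S.prim c g) (Icc 0 b) := by
  simpa [uIcc_of_le hb] using (absolutelyContinuous_prim hreg c hg hb).continuousOn

lemma aemeasurable_prim (hreg : S.RegularAtZero) (c : Fin n ⊕ Fin n → ℂ)
    {g : ℝ → Fin n ⊕ Fin n → ℂ} (hg : g ∈ S.preL2) :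
    AEMeasurable (S.prim c g) (volume.restrict (Ioi 0)) := by
  have h : ContinuousOn (S.prim c g) (Ioi 0) := fun x hx =>
    ((continuousOn_prim hreg c hg (b := x + 1) (by linarith [mem_Ioi.1 hx])).continuousAt
      (Icc_mem_nhds hx (by linarith))).continuousWithinAt
  exact h.aemeasurable measurableSet_Ioi

/-! ### Green's identity -/

/-- Green's identity on `(0, x)`. -/
lemma green (hreg : S.RegularAtZero) (c d : Fin n ⊕ Fin n → ℂ) {g k : ℝ → Fin n ⊕ Fin n → ℂ}
    (hg : g ∈ S.preL2) (hk : k ∈ S.preL2) {x : ℝ} (hx : 0 ≤ x) :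
    star (S.prim c g x) ⬝ᵥ (symplJ n *ᵥ S.prim d k x) = star c ⬝ᵥ (symplJ n *ᵥ d) +
      ∫ t in Ioc 0 x, (star (g t) ⬝ᵥ (S.H t *ᵥ S.prim d k t)
        - star (S.prim c g t) ⬝ᵥ (S.H t *ᵥ k t)) := by
  set F := S.prim c g with hF
  set K := S.prim d k with hK
  let φ : ℝ → ℂ := fun t => star (S.H t *ᵥ g t) ⬝ᵥ K t - star (F t) ⬝ᵥ (S.H t *ᵥ k t)
  have hcomp : ∀ {f : ℝ → Fin n ⊕ Fin n → ℂ}, AbsolutelyContinuousOnInterval f 0 x →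
      ∀ i, AbsolutelyContinuousOnInterval (fun t => f t i) 0 x := fun hf i =>
    hf.of_dist_le fun s _ t _ => dist_le_pi_dist _ _ i
  have hFac := absolutelyContinuous_prim hreg c hg hx
  have hKac := absolutelyContinuous_prim hreg d hk hx
  have hac : AbsolutelyContinuousOnInterval (fun t => star (F t) ⬝ᵥ (symplJ n *ᵥ K t)) 0 x := by
    simp only [dotProduct, mulVec, Pi.star_apply]
    refine .finset_sum _ fun i _ => ?_
    have h1 : AbsolutelyContinuousOnInterval (fun t => star (F t i)) 0 x :=
      (hcomp hFac i).of_dist_le fun s _ t _ => by rw [dist_star_star]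
    have h2 : AbsolutelyContinuousOnInterval (fun t => ∑ j, symplJ n i j * K t j) 0 x :=
      .finset_sum _ fun j _ => (hcomp hKac j).const_smul (symplJ n i j)
    exact h1.smul h2
  have hφ : IntervalIntegrable φ volume 0 x := by
    have hint : ∀ {f : ℝ → Fin n ⊕ Fin n → ℂ}, f ∈ S.preL2 → ∀ i,
        IntervalIntegrable (fun t => (S.H t *ᵥ f t) i) volume 0 x := fun hf i =>
      (intervalIntegrable_iff_integrableOn_Ioc_of_le hx).2 ((integrableOn_mulVec hreg hf x).eval i)
    have hsum : ∀ {f : Fin n ⊕ Fin n → ℝ → ℂ}, (∀ i, IntervalIntegrable (f i) volume 0 x) →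
        IntervalIntegrable (fun t => ∑ i, f i t) volume 0 x := fun {f} hf => by
      have := IntervalIntegrable.sum Finset.univ (f := f) fun i _ => hf i
      rwa [Finset.sum_fn] at this
    simp only [φ, dotProduct, Pi.star_apply]
    refine .sub (hsum fun i => ?_) (hsum fun i => ?_)
    · exact IntervalIntegrable.mul_continuousOn
        (⟨(Complex.conjCLE.toContinuousLinearMap).integrable_comp (hint hg i).1,
          (Complex.conjCLE.toContinuousLinearMap).integrable_comp (hint hg i).2⟩)
        (hcomp hKac i).continuousOn
    · exact (hint hk i).continuousOn_mul (continuous_star.comp_continuousOn (hcomp hFac i).continuousOn)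
  have hd : ∀ᵐ t, t ∈ uIcc 0 x → HasDerivAt (fun t => star (F t) ⬝ᵥ (symplJ n *ᵥ K t)) (φ t) t := by
    -- The derivatives of the primitives are known only on `(0, ∞)`, so the left endpoint is
    -- discarded.
    have h0 : ∀ᵐ t : ℝ, t ≠ 0 := by simp [ae_iff, measure_singleton]
    have h1 := ae_hasDerivAt_prim hreg c hg
    have h2 := ae_hasDerivAt_prim hreg d hk
    rw [ae_restrict_iff' measurableSet_Ioi] at h1 h2
    filter_upwards [h0, h1, h2] with t h0 h1 h2 ht
    rw [uIcc_of_le hx] at ht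
    have ht0 : t ∈ Ioi (0 : ℝ) := lt_of_le_of_ne ht.1 h0.symm
    have hFd := hasDerivAt_pi.1 (h1 ht0)
    have hKd : HasDerivAt (fun t => symplJ n *ᵥ K t) (-(S.H t *ᵥ k t)) t := by
      rw [← symplJ_mulVec_mulVec]
      exact ((LinearMap.toContinuousLinearMap (symplJ n).mulVecLin).restrictScalars
        ℝ).hasFDerivAt.comp_hasDerivAt t
        (h2 ht0)
    have hsum : HasDerivAt (fun t => ∑ i, star (F t i) * (symplJ n *ᵥ K t) i)
        (∑ i, (star ((symplJ n *ᵥ (S.H t *ᵥ g t)) i) * (symplJ n *ᵥ K t) i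
          + star (F t i) * (-(S.H t *ᵥ k t)) i)) t :=
      HasDerivAt.fun_sum fun i _ => (hFd i).star.mul (hasDerivAt_pi.1 hKd i)
    convert! hsum using 1
    rw [Finset.sum_add_distrib]
    change _ = star (symplJ n *ᵥ (S.H t *ᵥ g t)) ⬝ᵥ (symplJ n *ᵥ K t)
      + star (F t) ⬝ᵥ (-(S.H t *ᵥ k t))
    rw [star_symplJ_mulVec_dotProduct, symplJ_mulVec_mulVec, dotProduct_neg, dotProduct_neg,
      neg_neg, ← sub_eq_add_neg]
  have hmain := hac.integral_eq_sub_of_ae_hasDerivAt hφ hd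
  have hF0 : F 0 = c := prim_of_nonpos c g le_rfl
  have hK0 : K 0 = d := prim_of_nonpos d k le_rfl
  rw [hF0, hK0, intervalIntegral.integral_of_le hx] at hmain
  rw [eq_comm, ← eq_sub_iff_add_eq', ← hmain]
  refine integral_congr_ae ?_
  filter_upwards [ae_restrict_of_ae_restrict_of_subset Ioc_subset_Ioi_self S.posSemidef] with t ht
  simp only [φ, star_mulVec, ht.isHermitian.eq, dotProduct_mulVec]

/-- The limit exists without further assumptions, since both integrands in Green's identity are
integrable on `(0, ∞)`. -/
lemma tendsto_green (hreg : S.RegularAtZero) (c d : Fin n ⊕ Fin n → ℂ)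
    {g k : ℝ → Fin n ⊕ Fin n → ℂ} (hg : g ∈ S.preL2) (hk : k ∈ S.preL2)
    (hF : S.prim c g ∈ S.preL2) (hK : S.prim d k ∈ S.preL2) :
    Tendsto (fun x => star (S.prim c g x) ⬝ᵥ (symplJ n *ᵥ S.prim d k x)) atTop
      (𝓝 (star c ⬝ᵥ (symplJ n *ᵥ d) + (S.pairing g (S.prim d k) - S.pairing (S.prim c g) k))) := by
  have h1 := S.integrable_pairing hg hK
  have h2 := S.integrable_pairing hF hk
  have h3 := (intervalIntegral_tendsto_integral_Ioi 0 (h1.sub h2) tendsto_id).const_add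
    (star c ⬝ᵥ (symplJ n *ᵥ d))
  have h4 : ∫ x in Ioi 0, ((fun x => star (g x) ⬝ᵥ (S.H x *ᵥ S.prim d k x))
      - fun x => star (S.prim c g x) ⬝ᵥ (S.H x *ᵥ k x)) x
      = S.pairing g (S.prim d k) - S.pairing (S.prim c g) k := integral_sub h1 h2
  rw [h4] at h3
  refine h3.congr' ?_
  filter_upwards [eventually_ge_atTop 0] with x hx
  rw [green hreg c d hg hk hx, id_eq, intervalIntegral.integral_of_le hx]
  rfl

end CanonicalSystem
end

noncomputable section

namespace CanonicalSystem

variable {n : ℕ} {S : CanonicalSystem n}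

/-! ### Membership in `L²_H` -/

lemma density_congr {f g : ℝ → Fin n ⊕ Fin n → ℂ} {x : ℝ} (hx : (S.H x).PosSemidef)
    (h : S.H x *ᵥ f x = S.H x *ᵥ g x) : S.density f x = S.density g x := by
  unfold density
  rw [h, ← hx.isHermitian.star_dotProduct_mulVec, h, hx.isHermitian.star_dotProduct_mulVec]

lemma mem_preL2_congr {f g : ℝ → Fin n ⊕ Fin n → ℂ} (hf : f ∈ S.preL2)
    (hg : AEMeasurable g (volume.restrict (Ioi 0)))
    (h : ∀ᵐ x ∂volume.restrict (Ioi 0), S.H x *ᵥ f x = S.H x *ᵥ g x) : g ∈ S.preL2 := by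
  refine ⟨hg, lt_of_eq_of_lt (lintegral_congr_ae ?_) hf.2⟩
  filter_upwards [S.posSemidef, h] with x hx h
  exact density_congr hx h.symm

lemma indicator_mem_preL2 {f : ℝ → Fin n ⊕ Fin n → ℂ} (hf : f ∈ S.preL2) (b : ℝ) :
    (Ioc 0 b).indicator f ∈ S.preL2 := by
  refine ⟨hf.1.indicator measurableSet_Ioc, (lintegral_mono fun x => ?_).trans_lt hf.2⟩
  by_cases hx : x ∈ Ioc 0 b
  · simp [density, hx]
  · simp [density, hx]

/-- A measurable function which is bounded on `(0, b]` belongs to `L²_H` after truncation. -/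
lemma indicator_mem_preL2_of_bounded (hreg : S.RegularAtZero) {f : ℝ → Fin n ⊕ Fin n → ℂ}
    (hf : AEMeasurable f (volume.restrict (Ioi 0))) {b C : ℝ} (hC : ∀ x ∈ Icc 0 b, ‖f x‖ ≤ C) :
    (Ioc 0 b).indicator f ∈ S.preL2 := by
  refine ⟨hf.indicator measurableSet_Ioc, ?_⟩
  have hint : IntegrableOn (fun x => ∑ i, ∑ j, C * (‖S.H x i j‖ * C)) (Ioc 0 b) :=
    integrable_finsetSum _ fun i _ => integrable_finsetSum _ fun j _ =>
      (((integrableOn_H hreg b i j).norm.mul_const C).const_mul C)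
  calc S.sqNorm ((Ioc 0 b).indicator f)
      ≤ ∫⁻ x in Ioi 0, (Ioc 0 b).indicator
          (fun x => ENNReal.ofReal (∑ i, ∑ j, C * (‖S.H x i j‖ * C))) x := by
        refine lintegral_mono fun x => ?_
        by_cases hx : x ∈ Ioc 0 b
        · simp only [density, indicator_of_mem hx]
          refine ENNReal.ofReal_le_ofReal ((Complex.re_le_norm _).trans ?_)
          have hCx := hC x (Ioc_subset_Icc_self hx)
          have hC0 := (norm_nonneg _).trans hCx
          have hfi : ∀ i, ‖f x i‖ ≤ C := fun i => (norm_le_pi_norm (f x) i).trans hCx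
          simp only [dotProduct, mulVec, Finset.mul_sum, Pi.star_apply]
          refine (norm_sum_le _ _).trans (Finset.sum_le_sum fun i _ =>
            (norm_sum_le _ _).trans (Finset.sum_le_sum fun j _ => ?_))
          rw [norm_mul, norm_mul, norm_star]
          exact mul_le_mul (hfi i) (mul_le_mul_of_nonneg_left (hfi j) (norm_nonneg _))
            (by positivity) hC0
        · simp [density, hx]
    _ ≤ ∫⁻ x in Ioc 0 b, ENNReal.ofReal (∑ i, ∑ j, C * (‖S.H x i j‖ * C)) := by
        rw [lintegral_indicator measurableSet_Ioc]
        exact lintegral_mono_set' (Measure.restrict_le_self.absolutelyContinuous.ae_le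
          (Eventually.of_forall fun x hx => hx)) |>.trans (le_of_eq (by
            rw [Measure.restrict_restrict measurableSet_Ioc,
              inter_eq_left.2 Ioc_subset_Ioi_self]))
    _ < ∞ := hint.lintegral_lt_top

lemma indicator_prim_mem_preL2 (hreg : S.RegularAtZero) (c : Fin n ⊕ Fin n → ℂ)
    {g : ℝ → Fin n ⊕ Fin n → ℂ} (hg : g ∈ S.preL2) {b : ℝ} (hb : 0 ≤ b) :
    (Ioc 0 b).indicator (S.prim c g) ∈ S.preL2 := by
  obtain ⟨C, hC⟩ := isCompact_Icc.exists_bound_of_continuousOn (continuousOn_prim hreg c hg hb)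
  exact indicator_mem_preL2_of_bounded hreg (aemeasurable_prim hreg c hg) hC

/-! ### The boundary value at the left endpoint -/

/-- `c` is the value at `0` of the absolutely continuous representative of `p`. -/
def IsBoundaryValue (S : CanonicalSystem n) (p : S.Hilb × S.Hilb) (c : Fin n ⊕ Fin n → ℂ) : Prop :=
  ∃ (g : S.preL2) (h : S.prim c g ∈ S.preL2), S.toHilb ⟨S.prim c g, h⟩ = p.1 ∧ S.toHilb g = p.2

/-- The maximal relation, as a relation in the Hilbert space `L²_H(0, ∞)`. -/
def relation (S : CanonicalSystem n) : Submodule ℂ (S.Hilb × S.Hilb) := S.maximalRelation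

lemma isACRep_prim (hreg : S.RegularAtZero) (c : Fin n ⊕ Fin n → ℂ) (g : S.preL2)
    (h : S.prim c g ∈ S.preL2) :
    S.IsACRep (S.toHilb ⟨S.prim c g, h⟩, S.toHilb g) (S.prim c g) := by
  refine ⟨fun a b ha hab => ?_, h, rfl, g, rfl, ?_⟩
  · refine (absolutelyContinuous_prim hreg c g.2 (ha.le.trans hab)).mono ?_
    rw [uIcc_of_le hab, uIcc_of_le (ha.le.trans hab)]
    exact Icc_subset_Icc_left ha.le
  · filter_upwards [ae_hasDerivAt_prim hreg c g.2] with x hx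
    exact ⟨_, hx, symplJ_mulVec_mulVec _⟩

lemma IsBoundaryValue.mem (hreg : S.RegularAtZero) {p : S.Hilb × S.Hilb}
    {c : Fin n ⊕ Fin n → ℂ} (h : S.IsBoundaryValue p c) : p ∈ S.relation := by
  obtain ⟨g, hg, h1, h2⟩ := h
  have := isACRep_prim hreg c g hg
  rw [h1, h2] at this
  exact ⟨_, this⟩

/-- The representative minus `prim 0 g` has zero derivative almost everywhere and is absolutely
continuous, hence constant. This is how `f₀`, given only on `(0, ∞)`, acquires a value at `0`; the
base point `1` is arbitrary. -/
lemma IsACRep.exists_prim (hreg : S.RegularAtZero) {p : S.L2 × S.L2}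
    {f₀ : ℝ → Fin n ⊕ Fin n → ℂ} (hf : S.IsACRep p f₀) :
    ∃ (c : Fin n ⊕ Fin n → ℂ) (g : S.preL2) (h : S.prim c g ∈ S.preL2),
      S.toHilb ⟨S.prim c g, h⟩ = p.1 ∧ S.toHilb g = p.2 ∧ EqOn f₀ (S.prim c g) (Ioi 0) := by
  obtain ⟨hfa, hfm, hfp, g, hgp, hfg⟩ := hf
  have hd : ∀ᵐ x ∂volume.restrict (Ioi 0), HasDerivAt (f₀ - S.prim 0 g) 0 x := by
    filter_upwards [hfg, ae_hasDerivAt_prim hreg 0 g.2]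
    rintro x ⟨y, hy, hy'⟩ hx
    have hyw : y = symplJ n *ᵥ (S.H x *ᵥ (g : ℝ → Fin n ⊕ Fin n → ℂ) x) := by
      have := symplJ_mulVec_mulVec y
      rw [hy', mulVec_neg, neg_inj] at this
      exact this.symm
    simpa [hyw] using hy.sub hx
  have key : ∀ a b : ℝ, 0 < a → a ≤ b → (f₀ - S.prim 0 g) a = (f₀ - S.prim 0 g) b := by
    intro a b ha hab
    have hp : AbsolutelyContinuousOnInterval (S.prim 0 g) a b := by
      refine (absolutelyContinuous_prim hreg 0 g.2 (ha.le.trans hab)).mono ?_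
      rw [uIcc_of_le hab, uIcc_of_le (ha.le.trans hab)]
      exact Icc_subset_Icc_left ha.le
    obtain ⟨C, hC⟩ := ((hfa a b ha hab).sub hp).const_of_ae_hasDerivAt_zero (by
      rw [ae_restrict_iff' measurableSet_Ioi] at hd
      filter_upwards [hd] with x hx hxm
      rw [uIcc_of_le hab] at hxm
      exact hx (ha.trans_le hxm.1))
    rw [hC a left_mem_uIcc, hC b right_mem_uIcc]
  have heq : EqOn f₀ (S.prim ((f₀ - S.prim 0 g) 1) g) (Ioi 0) := by
    intro x hx
    have h1 : (f₀ - S.prim 0 g) 1 = (f₀ - S.prim 0 g) x := by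
      rcases le_total x 1 with h | h
      · exact (key x 1 hx h).symm
      · exact key 1 x one_pos h
    rw [prim_eq_add, h1, Pi.sub_apply, sub_add_cancel]
  have hae : ∀ᵐ x ∂volume.restrict (Ioi 0),
      S.H x *ᵥ f₀ x = S.H x *ᵥ S.prim ((f₀ - S.prim 0 g) 1) g x := by
    filter_upwards [ae_restrict_mem measurableSet_Ioi] with x hx
    rw [heq hx]
  have hm := mem_preL2_congr hfm (aemeasurable_prim hreg _ g.2) hae
  exact ⟨_, g, hm, (S.mk_eq_mk_of_ae hfm hm hae).symm.trans hfp, hgp, heq⟩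

lemma exists_isBoundaryValue (hreg : S.RegularAtZero) {p : S.Hilb × S.Hilb}
    (hp : p ∈ S.relation) : ∃ c, S.IsBoundaryValue p c := by
  obtain ⟨f₀, hf⟩ := hp
  obtain ⟨c, g, h, h1, h2, -⟩ := hf.exists_prim hreg
  exact ⟨c, g, h, h1, h2⟩

/-- Equal second components give equal integral terms, so `H (c - d) = 0` almost everywhere and
definiteness applies. -/
lemma IsBoundaryValue.unique (hdef : S.Definite) {p : S.Hilb × S.Hilb}
    {c d : Fin n ⊕ Fin n → ℂ} (hc : S.IsBoundaryValue p c) (hd : S.IsBoundaryValue p d) :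
    c = d := by
  obtain ⟨g, hg, h1, h2⟩ := hc
  obtain ⟨k, hk, h3, h4⟩ := hd
  have e1 := S.toHilb_eq_iff.1 (h1.trans h3.symm)
  have e2 : S.prim d g = S.prim d k := prim_congr d (S.toHilb_eq_iff.1 (h2.trans h4.symm))
  refine sub_eq_zero.1 (hdef _ ?_)
  filter_upwards [e1] with x hx
  simp only [← e2] at hx
  rw [prim_eq_add, prim_eq_add d, mulVec_add, mulVec_add, add_left_inj] at hx
  rw [mulVec_sub, hx, sub_self]

lemma IsBoundaryValue.add (hreg : S.RegularAtZero) {p q : S.Hilb × S.Hilb}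
    {c d : Fin n ⊕ Fin n → ℂ} (hc : S.IsBoundaryValue p c) (hd : S.IsBoundaryValue q d) :
    S.IsBoundaryValue (p + q) (c + d) := by
  obtain ⟨g, hg, h1, h2⟩ := hc
  obtain ⟨k, hk, h3, h4⟩ := hd
  have he : S.prim (c + d) (g + k : S.preL2) = S.prim c g + S.prim d k :=
    prim_add hreg c d g.2 k.2
  refine ⟨g + k, he ▸ S.preL2.add_mem hg hk, ?_, ?_⟩
  · rw [Prod.fst_add, ← h1, ← h3, ← map_add]
    exact congrArg _ (Subtype.ext he)
  · rw [Prod.snd_add, ← h2, ← h4, ← map_add]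

lemma IsBoundaryValue.smul {p : S.Hilb × S.Hilb} {c : Fin n ⊕ Fin n → ℂ} (a : ℂ)
    (hc : S.IsBoundaryValue p c) : S.IsBoundaryValue (a • p) (a • c) := by
  obtain ⟨g, hg, h1, h2⟩ := hc
  have he : S.prim (a • c) (a • g : S.preL2) = a • S.prim c g := prim_smul a c g
  refine ⟨a • g, he ▸ S.preL2.smul_mem a hg, ?_, ?_⟩
  · rw [Prod.smul_fst, ← h1, ← map_smul]
    exact congrArg _ (Subtype.ext he)
  · rw [Prod.smul_snd, ← h2, ← map_smul]

/-- The boundary value at `0`, as a linear map on the maximal relation. -/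
def boundaryValue (hdef : S.Definite) (hreg : S.RegularAtZero) :
    S.relation →ₗ[ℂ] (Fin n ⊕ Fin n → ℂ) where
  toFun p := (exists_isBoundaryValue hreg p.2).choose
  map_add' p q := (exists_isBoundaryValue hreg (p + q).2).choose_spec.unique hdef
    ((exists_isBoundaryValue hreg p.2).choose_spec.add hreg
      (exists_isBoundaryValue hreg q.2).choose_spec)
  map_smul' a p := (exists_isBoundaryValue hreg (a • p).2).choose_spec.unique hdef
    ((exists_isBoundaryValue hreg p.2).choose_spec.smul a)

lemma IsBoundaryValue.boundaryValue_eq (hdef : S.Definite) (hreg : S.RegularAtZero)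
    {p : S.relation} {c : Fin n ⊕ Fin n → ℂ} (h : S.IsBoundaryValue p c) :
    boundaryValue hdef hreg p = c :=
  (exists_isBoundaryValue hreg p.2).choose_spec.unique hdef h

lemma form_toHilb (f g h k : S.preL2) :
    LinearRelation.form (S.toHilb f, S.toHilb g) (S.toHilb h, S.toHilb k)
      = S.pairing g h - S.pairing f k := by
  simp only [LinearRelation.form, inner_toHilb]

/-- The boundary form at infinity is the limit of the symplectic form of the representatives. -/
lemma IsACRep.tendsto (hdef : S.Definite) (hreg : S.RegularAtZero) {p q : S.relation}
    {f₀ h₀ : ℝ → Fin n ⊕ Fin n → ℂ} (hf : S.IsACRep (p : S.Hilb × S.Hilb) f₀)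
    (hh : S.IsACRep (q : S.Hilb × S.Hilb) h₀) :
    Tendsto (fun x => star (f₀ x) ⬝ᵥ (symplJ n *ᵥ h₀ x)) atTop
      (𝓝 (LinearRelation.boundaryForm (boundaryValue hdef hreg) p q)) := by
  obtain ⟨c, g, hg, h1, h2, h3⟩ := hf.exists_prim hreg
  obtain ⟨d, k, hk, h4, h5, h6⟩ := hh.exists_prim hreg
  have hc : S.IsBoundaryValue p c := ⟨g, hg, h1, h2⟩
  have hd : S.IsBoundaryValue q d := ⟨k, hk, h4, h5⟩
  have hform : LinearRelation.form (p : S.Hilb × S.Hilb) q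
      = S.pairing g (S.prim d k) - S.pairing (S.prim c g) k := by
    rw [← form_toHilb ⟨_, hg⟩ g ⟨_, hk⟩ k, h1, h2, h4, h5]
  rw [LinearRelation.boundaryForm, hc.boundaryValue_eq hdef hreg, hd.boundaryValue_eq hdef hreg,
    hform]
  refine (tendsto_green hreg c d g.2 k.2 hg hk).congr' ?_
  filter_upwards [eventually_gt_atTop 0] with x hx
  rw [h3 hx, h6 hx]

end CanonicalSystem
end

noncomputable section

namespace CanonicalSystem

variable {n : ℕ} {S : CanonicalSystem n}

/-! ### Elements with compact support -/

lemma prim_eq_of_le {c : Fin n ⊕ Fin n → ℂ} {g : ℝ → Fin n ⊕ Fin n → ℂ} {b : ℝ}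
    (hg : ∀ x ∉ Ioc 0 b, g x = 0) {x : ℝ} (hx : b ≤ x) :
    S.prim c g x = S.prim c g b := by
  unfold prim
  congr 1
  refine setIntegral_eq_of_subset_of_forall_sdiff_eq_zero measurableSet_Ioc
    (Ioc_subset_Ioc_right hx) fun t ht => ?_
  rw [hg t ht.2, mulVec_zero, mulVec_zero]

/-- A primitive which vanishes from some point on is square integrable. -/
lemma prim_mem_preL2 (hreg : S.RegularAtZero) {c : Fin n ⊕ Fin n → ℂ}
    {g : ℝ → Fin n ⊕ Fin n → ℂ} (hg : g ∈ S.preL2) {b : ℝ} (hb : 0 ≤ b)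
    (hg0 : ∀ x ∉ Ioc 0 b, g x = 0) (h0 : S.prim c g b = 0) : S.prim c g ∈ S.preL2 := by
  refine mem_preL2_congr (indicator_prim_mem_preL2 hreg c hg hb) (aemeasurable_prim hreg c hg) ?_
  filter_upwards [ae_restrict_mem measurableSet_Ioi] with x hx
  by_cases hxb : x ∈ Ioc 0 b
  · rw [indicator_of_mem hxb]
  · have : b ≤ x := le_of_lt (not_le.1 fun h => hxb ⟨hx, h⟩)
    rw [indicator_of_notMem hxb, prim_eq_of_le hg0 this, h0]

/-- The boundary form is a limit at infinity by `IsACRep.tendsto`, and here the function is zero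
from `b` on. -/
lemma exists_boundaryForm_eq_zero (hdef : S.Definite) (hreg : S.RegularAtZero)
    {c : Fin n ⊕ Fin n → ℂ} {g : S.preL2} {b : ℝ} (hb : 0 ≤ b)
    (hg0 : ∀ x ∉ Ioc 0 b, (g : ℝ → Fin n ⊕ Fin n → ℂ) x = 0) (h0 : S.prim c g b = 0) :
    ∃ p : S.relation, S.IsBoundaryValue p c ∧
      (p : S.Hilb × S.Hilb) = (S.toHilb ⟨_, prim_mem_preL2 hreg g.2 hb hg0 h0⟩, S.toHilb g) ∧
      ∀ q, LinearRelation.boundaryForm (boundaryValue hdef hreg) p q = 0 := by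
  have hbv : S.IsBoundaryValue
      (S.toHilb ⟨_, prim_mem_preL2 hreg g.2 hb hg0 h0⟩, S.toHilb g) c := ⟨g, _, rfl, rfl⟩
  refine ⟨⟨_, hbv.mem hreg⟩, hbv, rfl, fun q => ?_⟩
  obtain ⟨h₀, hq⟩ := q.2
  refine tendsto_nhds_unique (IsACRep.tendsto hdef hreg (p := ⟨_, hbv.mem hreg⟩)
    (isACRep_prim hreg c g (prim_mem_preL2 hreg g.2 hb hg0 h0)) hq) (tendsto_const_nhds.congr' ?_)
  filter_upwards [eventually_ge_atTop b] with x hx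
  rw [prim_eq_of_le hg0 hx, h0, star_zero, zero_dotProduct]

/-! ### The matrix `∫₀ᵇ H` -/

/-- The matrix `∫₀ᵇ H`. -/
def gram (S : CanonicalSystem n) (b : ℝ) : Matrix (Fin n ⊕ Fin n) (Fin n ⊕ Fin n) ℂ :=
  Matrix.of fun i j => ∫ x in Ioc 0 b, S.H x i j

lemma integrableOn_mulVec_const (hreg : S.RegularAtZero) (b : ℝ) (v : Fin n ⊕ Fin n → ℂ) :
    IntegrableOn (fun x => S.H x *ᵥ v) (Ioc 0 b) := by
  refine Integrable.of_eval fun i => ?_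
  simp only [mulVec, dotProduct]
  exact integrable_finsetSum _ fun j _ => (integrableOn_H hreg b i j).mul_const (v j)

lemma ae_restrict_Ioc {P : ℝ → Prop} (h : ∀ᵐ x ∂volume.restrict (Ioi 0), P x) (b : ℝ) :
    ∀ᵐ x ∂volume.restrict (Ioc 0 b), P x :=
  ae_restrict_of_ae_restrict_of_subset Ioc_subset_Ioi_self h

lemma gram_mulVec (hreg : S.RegularAtZero) (b : ℝ) (v : Fin n ⊕ Fin n → ℂ) :
    S.gram b *ᵥ v = ∫ x in Ioc 0 b, S.H x *ᵥ v := by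
  ext i
  rw [eval_integral fun i => (integrableOn_mulVec_const hreg b v).eval i]
  simp only [mulVec, dotProduct, gram, of_apply]
  rw [integral_finsetSum _ fun j _ => (integrableOn_H hreg b i j).mul_const (v j)]
  simp only [integral_mul_const]

/-- The nonnegative function `v* H v` has integral zero. -/
lemma ae_mulVec_eq_zero_of_gram (hreg : S.RegularAtZero) {b : ℝ} {v : Fin n ⊕ Fin n → ℂ}
    (h : S.gram b *ᵥ v = 0) : ∀ᵐ x ∂volume.restrict (Ioc 0 b), S.H x *ᵥ v = 0 := by
  have hint : IntegrableOn (fun x => S.H x *ᵥ v) (Ioc 0 b) :=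
    integrableOn_mulVec_const hreg b v
  have hi : IntegrableOn (fun x => (star v ⬝ᵥ (S.H x *ᵥ v)).re) (Ioc 0 b) :=
    (integrable_finsetSum _ fun i _ => (hint.eval i).const_mul (star v i)).re
  have hpos := ae_restrict_Ioc S.posSemidef b
  have h0 : ∫ x in Ioc 0 b, (star v ⬝ᵥ (S.H x *ᵥ v)).re = 0 := by
    have h1 : ∫ x in Ioc 0 b, star v ⬝ᵥ (S.H x *ᵥ v) = 0 := by
      have h2 : star v ⬝ᵥ ∫ x in Ioc 0 b, S.H x *ᵥ v = 0 := by
        rw [← gram_mulVec hreg, h, dotProduct_zero]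
      rw [← h2]
      simp only [dotProduct]
      rw [integral_finsetSum _ fun i _ => (hint.eval i).const_mul (star v i)]
      exact Finset.sum_congr rfl fun i _ => by
        rw [integral_const_mul, eval_integral fun i => hint.eval i]
    have h3 := integral_re (𝕜 := ℂ) (f := fun x => star v ⬝ᵥ (S.H x *ᵥ v))
      (μ := volume.restrict (Ioc 0 b))
      (integrable_finsetSum _ fun i _ => (hint.eval i).const_mul (star v i))
    rw [h1] at h3
    exact h3
  have hnn : 0 ≤ᵐ[volume.restrict (Ioc 0 b)] fun x => (star v ⬝ᵥ (S.H x *ᵥ v)).re :=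
    hpos.mono fun x hx => (Complex.le_def.1 (hx.dotProduct_mulVec_nonneg v)).1
  filter_upwards [(integral_eq_zero_iff_of_nonneg_ae hnn hi).1 h0, hpos] with x hx hp
  exact (hp.dotProduct_mulVec_zero_iff v).1
    (Complex.ext hx (Complex.le_def.1 (hp.dotProduct_mulVec_nonneg v)).2.symm)

/-- The constant vectors annihilated by `H` on `(0, b]`. -/
def constKer (S : CanonicalSystem n) (b : ℝ) : Submodule ℂ (Fin n ⊕ Fin n → ℂ) where
  carrier := {v | ∀ᵐ x ∂volume.restrict (Ioc 0 b), S.H x *ᵥ v = 0}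
  zero_mem' := by
    change ∀ᵐ x ∂volume.restrict (Ioc 0 b), S.H x *ᵥ 0 = 0
    exact .of_forall fun x => mulVec_zero _
  add_mem' := fun {v w} hv hw => by
    change ∀ᵐ x ∂volume.restrict (Ioc 0 b), S.H x *ᵥ (v + w) = 0
    filter_upwards [hv, hw] with x h1 h2
    rw [mulVec_add, h1, h2, add_zero]
  smul_mem' := fun c v hv => by
    change ∀ᵐ x ∂volume.restrict (Ioc 0 b), S.H x *ᵥ (c • v) = 0
    filter_upwards [hv] with x h1
    rw [mulVec_smul, h1, smul_zero]

lemma constKer_anti {a b : ℝ} (hab : a ≤ b) : S.constKer b ≤ S.constKer a := fun _ hv =>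
  ae_restrict_of_ae_restrict_of_subset (Ioc_subset_Ioc_right hab) hv

lemma ae_Ioi_of_forall_nat {P : ℝ → Prop} (b : ℝ)
    (h : ∀ m : ℕ, ∀ᵐ x ∂volume.restrict (Ioc 0 (b + m)), P x) :
    ∀ᵐ x ∂volume.restrict (Ioi 0), P x := by
  rw [ae_restrict_iff' measurableSet_Ioi]
  filter_upwards [ae_all_iff.2 fun m => (ae_restrict_iff' measurableSet_Ioc).1 (h m)] with x hx hx0
  obtain ⟨m, hm⟩ := exists_nat_ge (x - b)
  exact hx m ⟨hx0, by linarith⟩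

/-- The subspaces `constKer m` decrease in a finite-dimensional space, hence stabilize, and a vector
in the final one is annihilated by `H` on all of `(0, ∞)`. -/
lemma exists_constKer_eq_bot (hdef : S.Definite) : ∃ b : ℝ, 0 < b ∧ S.constKer b = ⊥ := by
  obtain ⟨M, hM⟩ := IsArtinian.monotone_stabilizes
    (⟨fun m : ℕ => OrderDual.toDual (S.constKer m), fun a b hab =>
      constKer_anti (Nat.cast_le.2 hab)⟩ : ℕ →o (Submodule ℂ (Fin n ⊕ Fin n → ℂ))ᵒᵈ)
  have hM' : ∀ m : ℕ, M ≤ m → S.constKer M = S.constKer m := hM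
  -- The shift by one ensures `0 < b` even when `M = 0`.
  refine ⟨M + 1, by positivity, (Submodule.eq_bot_iff _).2 fun v hv => hdef v ?_⟩
  have hv' : v ∈ S.constKer M := constKer_anti (by linarith) hv
  refine ae_Ioi_of_forall_nat M fun m => ?_
  have := hM' (M + m) (Nat.le_add_right _ _) ▸ hv'
  rw [Nat.cast_add] at this
  exact this

lemma exists_gram_mulVec_eq (hreg : S.RegularAtZero) {b : ℝ} (hb : S.constKer b = ⊥)
    (w : Fin n ⊕ Fin n → ℂ) : ∃ v, S.gram b *ᵥ v = w := by
  have hi : Function.Injective (S.gram b).mulVecLin :=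
    (injective_iff_map_eq_zero _).2 fun v hv =>
      (Submodule.eq_bot_iff _).1 hb v (ae_mulVec_eq_zero_of_gram hreg hv)
  exact LinearMap.injective_iff_surjective.1 hi w

/-! ### The hypotheses of the abstract theorem -/

/-- The value `v` is steered to `0` at `b` by a constant `c` on `(0, b]`. At `b` the primitive
equals `v + J (∫₀ᵇ H) c`, which vanishes if `(∫₀ᵇ H) c = J v`; this is solvable because `∫₀ᵇ H` is
invertible for large `b`. -/
lemma exists_boundaryValue_eq (hdef : S.Definite) (hreg : S.RegularAtZero)
    (v : Fin n ⊕ Fin n → ℂ) : ∃ p, boundaryValue hdef hreg p = v ∧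
      ∀ q, LinearRelation.boundaryForm (boundaryValue hdef hreg) p q = 0 := by
  obtain ⟨b, hb, hker⟩ := exists_constKer_eq_bot hdef
  obtain ⟨c, hc⟩ := exists_gram_mulVec_eq hreg hker (symplJ n *ᵥ v)
  have hg : (Ioc 0 b).indicator (fun _ => c) ∈ S.preL2 :=
    indicator_mem_preL2_of_bounded hreg aemeasurable_const (C := ‖c‖) fun x _ => le_rfl
  have hg0 : ∀ x ∉ Ioc 0 b, (Ioc 0 b).indicator (fun _ => c) x = 0 := fun x hx =>
    indicator_of_notMem hx _
  have h0 : S.prim v ((Ioc 0 b).indicator fun _ => c) b = 0 := by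
    have h1 : ∫ t in Ioc 0 b, symplJ n *ᵥ (S.H t *ᵥ (Ioc 0 b).indicator (fun _ => c) t)
        = symplJ n *ᵥ (S.gram b *ᵥ c) := by
      rw [gram_mulVec hreg]
      have h2 := (LinearMap.toContinuousLinearMap (symplJ n).mulVecLin).integral_comp_comm
        (integrableOn_mulVec hreg hg b)
      refine h2.trans (congrArg (symplJ n).mulVecLin ?_)
      exact setIntegral_congr_fun measurableSet_Ioc fun t ht => by
        simp only [indicator_of_mem ht]
    rw [prim, h1, hc, symplJ_mulVec_mulVec, add_neg_cancel]
  obtain ⟨p, hp, -, hp0⟩ := exists_boundaryForm_eq_zero hdef hreg (g := ⟨_, hg⟩) hb.le hg0 h0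
  exact ⟨p, hp.boundaryValue_eq hdef hreg, hp0⟩

/-- A square integrable function which is orthogonal on `(0, b]` to all `g` with `∫₀ᵇ H g = 0` is
constant on `(0, b]`. -/
lemma exists_ae_eq_const (hreg : S.RegularAtZero) {b : ℝ}
    (hker : S.constKer b = ⊥) {d : ℝ → Fin n ⊕ Fin n → ℂ} (hd : (Ioc 0 b).indicator d ∈ S.preL2)
    (horth : ∀ g ∈ S.preL2, (∀ x ∉ Ioc 0 b, g x = 0) → ∫ x in Ioc 0 b, S.H x *ᵥ g x = 0 →
      S.pairing g ((Ioc 0 b).indicator d) = 0) :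
    ∃ c, ∀ᵐ x ∂volume.restrict (Ioc 0 b), S.H x *ᵥ d x = S.H x *ᵥ c := by
  -- With this `c`, `∫₀ᵇ H (D - K) = 0`. So `D - K` is an admissible test function, orthogonal to
  -- `D` by assumption and to the constant `K` directly, hence to itself.
  obtain ⟨c, hc⟩ := exists_gram_mulVec_eq hreg hker
    (∫ x in Ioc 0 b, S.H x *ᵥ (Ioc 0 b).indicator d x)
  have hcm : (Ioc 0 b).indicator (fun _ => c) ∈ S.preL2 :=
    indicator_mem_preL2_of_bounded hreg aemeasurable_const (C := ‖c‖) fun x _ => le_rfl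
  set D := (Ioc 0 b).indicator d with hD
  set K := (Ioc 0 b).indicator fun _ => c with hK
  have hDK : D - K ∈ S.preL2 := S.preL2.sub_mem hd hcm
  have hsupp : ∀ x ∉ Ioc 0 b, (D - K) x = 0 := fun x hx => by
    simp [hD, hK, indicator_of_notMem hx]
  have hint0 : ∫ x in Ioc 0 b, S.H x *ᵥ (D - K) x = 0 := by
    simp only [Pi.sub_apply, mulVec_sub]
    rw [integral_sub (integrableOn_mulVec hreg hd b) (integrableOn_mulVec hreg hcm b), ← hc,
      gram_mulVec hreg, sub_eq_zero]
    exact setIntegral_congr_fun measurableSet_Ioc fun t ht => by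
      simp only [hK, indicator_of_mem ht]
  have h1 : S.pairing (D - K) D = 0 := horth _ hDK hsupp hint0
  have h2 : S.pairing K (D - K) = 0 := by
    have hint := integrableOn_mulVec hreg hDK b
    have h3 : S.pairing K (D - K) = ∫ x in Ioc 0 b, star c ⬝ᵥ (S.H x *ᵥ (D - K) x) := by
      refine (setIntegral_eq_of_subset_of_forall_sdiff_eq_zero measurableSet_Ioi
        Ioc_subset_Ioi_self fun x hx => ?_).trans
        (setIntegral_congr_fun measurableSet_Ioc fun t ht => ?_)
      · rw [hsupp x hx.2, mulVec_zero, dotProduct_zero]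
      · simp only [hK, indicator_of_mem ht]
    rw [h3]
    simp only [dotProduct]
    rw [integral_finsetSum _ fun i _ => (hint.eval i).const_mul (star c i)]
    refine Finset.sum_eq_zero fun i _ => ?_
    rw [integral_const_mul, ← eval_integral fun i => hint.eval i, hint0, Pi.zero_apply, mul_zero]
  have h4 : S.pairing (D - K) (D - K) = 0 := by
    rw [S.pairing_sub_right hDK hd hcm, h1, ← S.pairing_star K, h2, star_zero, sub_zero]
  have h5 : S.sqNorm (D - K) = 0 := by
    have h6 := S.pairing_self_re _ hDK
    rw [h4, Complex.zero_re] at h6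
    exact ((ENNReal.toReal_eq_zero_iff _).1 h6.symm).resolve_right hDK.2.ne
  refine ⟨c, ?_⟩
  filter_upwards [ae_restrict_Ioc (S.ae_mulVec_eq_zero hDK.1 h5) b, ae_restrict_mem measurableSet_Ioc] with x hx hxm
  rwa [Pi.sub_apply, mulVec_sub, sub_eq_zero, hD, hK, indicator_of_mem hxm,
    indicator_of_mem hxm] at hx

/-- Integration by parts against a primitive vanishing at both ends of `(0, a]`. -/
lemma pairing_prim (hreg : S.RegularAtZero) {g k : ℝ → Fin n ⊕ Fin n → ℂ} (hk : k ∈ S.preL2)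
    (hg : g ∈ S.preL2) {a : ℝ} (ha0 : 0 ≤ a) (hg0 : ∀ x ∉ Ioc 0 a, g x = 0)
    (h0 : S.prim 0 g a = 0) :
    S.pairing (S.prim 0 g) k = S.pairing g ((Ioc 0 a).indicator (S.prim 0 k)) := by
  have hkm := indicator_prim_mem_preL2 hreg 0 hk ha0
  have hF := prim_mem_preL2 hreg hg ha0 hg0 h0
  have e1 : ∫ x in Ioc 0 a, star (S.prim 0 g x) ⬝ᵥ (S.H x *ᵥ k x)
      = S.pairing (S.prim 0 g) k := by
    refine (setIntegral_eq_of_subset_of_forall_sdiff_eq_zero measurableSet_Ioi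
      Ioc_subset_Ioi_self fun x hx => ?_).symm
    have hx' : a ≤ x := le_of_lt (not_le.1 fun h => hx.2 ⟨hx.1, h⟩)
    rw [prim_eq_of_le hg0 hx', h0, star_zero, zero_dotProduct]
  have e2 : ∫ x in Ioc 0 a, star (g x) ⬝ᵥ (S.H x *ᵥ S.prim 0 k x)
      = S.pairing g ((Ioc 0 a).indicator (S.prim 0 k)) := by
    refine Eq.trans (setIntegral_congr_fun measurableSet_Ioc fun x hx => ?_)
      (setIntegral_eq_of_subset_of_forall_sdiff_eq_zero measurableSet_Ioi
        Ioc_subset_Ioi_self fun x hx => ?_).symm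
    · simp only [indicator_of_mem hx]
    · rw [hg0 x hx.2, star_zero, zero_dotProduct]
  have i1 : IntegrableOn (fun x => star (g x) ⬝ᵥ (S.H x *ᵥ S.prim 0 k x)) (Ioc 0 a) :=
    (IntegrableOn.mono_set (S.integrable_pairing hg hkm) Ioc_subset_Ioi_self).congr_fun
      (fun x hx => by simp only [indicator_of_mem hx]) measurableSet_Ioc
  have i2 : IntegrableOn (fun x => star (S.prim 0 g x) ⬝ᵥ
      (S.H x *ᵥ k x)) (Ioc 0 a) :=
    IntegrableOn.mono_set (S.integrable_pairing hF hk) Ioc_subset_Ioi_self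
  have hgr := green hreg 0 0 hg hk ha0
  rw [h0, star_zero, zero_dotProduct, zero_dotProduct, zero_add, integral_sub i1 i2, e1, e2]
    at hgr
  exact (sub_eq_zero.1 hgr.symm).symm

lemma exists_mem_radical (hdef : S.Definite) (hreg : S.RegularAtZero) {g : S.preL2} {a : ℝ}
    (ha0 : 0 ≤ a) (hg0 : ∀ x ∉ Ioc 0 a, (g : ℝ → Fin n ⊕ Fin n → ℂ) x = 0)
    (h0 : S.prim 0 g a = 0) :
    (S.toHilb ⟨_, prim_mem_preL2 hreg g.2 ha0 hg0 h0⟩, S.toHilb g)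
      ∈ LinearRelation.radical S.relation := by
  obtain ⟨p, hp, hpe, hp0⟩ := exists_boundaryForm_eq_zero hdef hreg ha0 hg0 h0
  rw [← hpe]
  refine ⟨p.2, fun r hr => ?_⟩
  have := hp0 ⟨r, hr⟩
  rwa [LinearRelation.boundaryForm, hp.boundaryValue_eq hdef hreg, star_zero, zero_dotProduct,
    zero_add] at this

lemma pairing_indicator_right {g h : ℝ → Fin n ⊕ Fin n → ℂ} {a : ℝ}
    (hg0 : ∀ x ∉ Ioc 0 a, g x = 0) : S.pairing g ((Ioc 0 a).indicator h) = S.pairing g h := by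
  refine integral_congr_ae (.of_forall fun x => ?_)
  by_cases hx : x ∈ Ioc 0 a
  · simp only [indicator_of_mem hx]
  · simp only [hg0 x hx, star_zero, zero_dotProduct]

/-- A du Bois-Reymond argument: if `g` is supported in `(0, a]` and `∫₀ᵃ H g = 0`, its primitive
vanishes at both ends and yields an element of the radical. Integrating by parts in `hq` makes `h -
prim 0 k` orthogonal to `g`. -/
lemma exists_ae_sub_prim_eq_const (hdef : S.Definite) (hreg : S.RegularAtZero) {h k : S.preL2}
    (hq : ∀ p ∈ LinearRelation.radical S.relation,
      LinearRelation.form p (S.toHilb h, S.toHilb k) = 0) {a : ℝ} (ha0 : 0 ≤ a)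
    (hker : S.constKer a = ⊥) : ∃ c, ∀ᵐ x ∂volume.restrict (Ioc 0 a),
      S.H x *ᵥ ((h : ℝ → Fin n ⊕ Fin n → ℂ) - S.prim 0 k) x = S.H x *ᵥ c := by
  have hind : (Ioc 0 a).indicator ((h : ℝ → Fin n ⊕ Fin n → ℂ) - S.prim 0 k)
      = (Ioc 0 a).indicator h - (Ioc 0 a).indicator (S.prim 0 k) := indicator_sub' _ _ _
  have hh := indicator_mem_preL2 h.2 a
  have hk := indicator_prim_mem_preL2 hreg 0 k.2 ha0
  refine exists_ae_eq_const hreg hker (hind ▸ S.preL2.sub_mem hh hk) fun g hg hg0 hgi => ?_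
  have h0 : S.prim 0 g a = 0 := by
    have h2 := (LinearMap.toContinuousLinearMap (symplJ n).mulVecLin).integral_comp_comm
      (integrableOn_mulVec hreg hg a)
    rw [hgi, map_zero] at h2
    rw [prim, zero_add]
    exact h2
  have h1 := hq _ (exists_mem_radical hdef hreg (g := ⟨g, hg⟩) ha0 hg0 h0)
  rw [form_toHilb] at h1
  rw [hind, S.pairing_sub_right hg hh hk, pairing_indicator_right hg0,
    ← pairing_prim hreg k.2 hg ha0 hg0 h0]
  exact h1

/-- The local constants on the intervals `(0, a]` coincide, because any two differ by an element of
`constKer b = ⊥`; hence `h` is represented by a single primitive of `k`. -/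
lemma toHilb_mem_relation (hdef : S.Definite) (hreg : S.RegularAtZero) {h k : S.preL2}
    (hq : ∀ p ∈ LinearRelation.radical S.relation,
      LinearRelation.form p (S.toHilb h, S.toHilb k) = 0) :
    (S.toHilb h, S.toHilb k) ∈ S.relation := by
  obtain ⟨b, hb, hker⟩ := exists_constKer_eq_bot hdef
  have hloc : ∀ a : ℝ, b ≤ a → ∃ c, ∀ᵐ x ∂volume.restrict (Ioc 0 a),
      S.H x *ᵥ ((h : ℝ → Fin n ⊕ Fin n → ℂ) - S.prim 0 k) x = S.H x *ᵥ c := fun a ha =>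
    exists_ae_sub_prim_eq_const hdef hreg hq (hb.le.trans ha)
      (le_bot_iff.1 ((constKer_anti ha).trans hker.le))
  obtain ⟨c, hc⟩ := hloc b le_rfl
  have hae : ∀ᵐ x ∂volume.restrict (Ioi 0),
      S.H x *ᵥ (h : ℝ → Fin n ⊕ Fin n → ℂ) x = S.H x *ᵥ S.prim c k x := by
    refine ae_Ioi_of_forall_nat b fun m => ?_
    have hbm : b ≤ b + m := by linarith [Nat.cast_nonneg (α := ℝ) m]
    obtain ⟨c', hc'⟩ := hloc (b + m) hbm
    have hcc : c' - c ∈ S.constKer b := by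
      change ∀ᵐ x ∂_, _
      filter_upwards [hc, ae_restrict_of_ae_restrict_of_subset (Ioc_subset_Ioc_right hbm) hc']
        with x h1 h2
      rw [mulVec_sub, ← h1, ← h2, sub_self]
    rw [hker, Submodule.mem_bot, sub_eq_zero] at hcc
    filter_upwards [hc'] with x hx
    rw [prim_eq_add, mulVec_add, ← hcc, ← hx, ← mulVec_add, Pi.sub_apply, sub_add_cancel]
  have hm := mem_preL2_congr h.2 (aemeasurable_prim hreg c k.2) hae
  have he : S.toHilb ⟨S.prim c k, hm⟩ = S.toHilb h :=
    S.toHilb_eq_iff.2 (hae.mono fun x hx => hx.symm)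
  have hbv : S.IsBoundaryValue (S.toHilb h, S.toHilb k) c := ⟨k, hm, he, rfl⟩
  exact hbv.mem hreg

/-- The adjoint of the radical is contained in the maximal relation. -/
lemma mem_relation_of_form_eq_zero (hdef : S.Definite) (hreg : S.RegularAtZero)
    (q : S.Hilb × S.Hilb)
    (hq : ∀ p ∈ LinearRelation.radical S.relation, LinearRelation.form p q = 0) :
    q ∈ S.relation := by
  have hrep : q = (S.toHilb (S.rep q.1), S.toHilb (S.rep q.2)) := by
    rw [toHilb_rep, toHilb_rep]
  rw [hrep] at hq ⊢
  exact toHilb_mem_relation hdef hreg hq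

end CanonicalSystem
end

/-! ### The main theorem -/

theorem mainTheorem10 {n : ℕ} (S : CanonicalSystem n) (hdef : S.Definite)
    (hreg : S.RegularAtZero) :
    (S.deficiencyIndex Complex.I = n ∧ S.deficiencyIndex (-Complex.I) = n) ↔
      ∀ p ∈ S.maximalRelation, ∀ q ∈ S.maximalRelation,
        ∀ f₀ h₀ : ℝ → Fin n ⊕ Fin n → ℂ, S.IsACRep p f₀ → S.IsACRep q h₀ →
          Tendsto (fun x => star (f₀ x) ⬝ᵥ (symplJ n *ᵥ h₀ x)) atTop (𝓝 0) := by
  have key := LinearRelation.rank_defect_eq_iff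
    (CanonicalSystem.mem_relation_of_form_eq_zero hdef hreg)
    (CanonicalSystem.exists_boundaryValue_eq hdef hreg)
  -- `Hilb` is `L2` with a norm, so the ranks in `key` are the deficiency indices by definition.
  -- Only the boundary form has to be matched with the limit.
  refine Iff.trans key ⟨fun h p hp q hq f₀ h₀ hf hh => ?_, fun h p q => ?_⟩
  · have := CanonicalSystem.IsACRep.tendsto hdef hreg (p := ⟨p, hp⟩) (q := ⟨q, hq⟩) hf hh
    rwa [h] at this
  · obtain ⟨f₀, hf⟩ := p.2
    obtain ⟨h₀, hh⟩ := q.2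
    exact tendsto_nhds_unique (CanonicalSystem.IsACRep.tendsto hdef hreg hf hh)
      (h p.1 p.2 q.1 q.2 f₀ h₀ hf hh)
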